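/- A strict partition is a finite strictly decreasing sequence $\bar\lambda=(\bar\lambda_1>\dots>\bar\lambda_\ell>0)$ of positive integers (possibly empty), with size $|\bar\lambda|=\sum_i\bar\lambda_i$, length $\ell(\bar\lambda)=\ell$, and $\bar\lambda_i=0$ for $i>\ell$. Its shifted Young diagram consists of the boxes $(i,j)$ with $1\le i\le \ell$ and $i+1\le j\le i+\bar\lambda_i$. The hook length of the box $(i,j)$ is the number of boxes to its right in row $i$, plus the number of boxes below it in column $j$, plus $1$, plus $\bar\lambda_j$; let $H(\bar\lambda)$ be the product of the hook lengths of all boxes. Write $\bar\lambda\supseteq\bar\mu$ if $\bar\lambda_i\ge\bar\mu_i$ for all $i\geq 1$; then $\bar\lambda/\bar\mu$ is the set of boxes of $\bar\lambda$ that are not boxes of $\bar\mu$, $|\bar\lambda/\bar\mu|$ is their number, and $f_{\bar\lambda/\bar\mu}$ is the number of standard shifted Young tableaux of shape $\bar\lambda/\bar\mu$, i.e. of bijective fillings of its boxes with $1,\dots,|\bar\lambda/\bar\mu|$ increasing along rows and down columns. The doubled distinct partition $\bar\lambda\bar\lambda$ is the usual partition whose Young diagram is obtained from the shifted diagram of $\bar\lambda$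 by adding $\bar\lambda_i$ boxes at the bottom of column $i$ for $1\le i\le\ell$. For a usual partition $\lambda$, let $\mathcal H(\lambda)$ be the multiset of its (ordinary) hook lengths and $H(\lambda)=\prod_{h\in\mathcal H(\lambda)}h$. Put $p^1(\bar\lambda)=\sum_{h\in\mathcal H(\bar\lambda\bar\lambda)}h^2$. **Theorem.** For every strict partition $\bar\mu$ and every integer $n\ge 0$, $$\sum_{\substack{\bar\lambda\supseteq\bar\mu\\ |\bar\lambda/\bar\mu|=n}}\frac{2^{|\bar\lambda|-\ell(\bar\lambda)-|\bar\mu|+\ell(\bar\mu)}\,f_{\bar\lambda/\bar\mu}\,H(\bar\mu)}{H(\bar\lambda)}\bigl(p^1(\bar\lambda)-p^1(\bar\mu)\bigr)=12\binom n2+(12|\bar\mu|+5)\,n ,$$ where the sum is over strict partitions $\bar\lambda$. Moreover, for every integer $n\ge0$, $$2^n\,n!\sum_{|\bar\lambda\bar\lambda|=2n}\frac1{H(\bar\lambda\bar\lambda)}\sum_{h\in\mathcal H(\bar\lambda\bar\lambda)}h^2=12\binom n2+5n ,$$ where the sum is over strict partitions $\bar\lambda$ whose doubled distinct partition has size $2n$.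 -/

import Mathlib

/-- A strict partition: a finite strictly decreasing sequence of positive integers. -/
@[ext]
structure StrictPartition where
  /-- the parts, listed in decreasing order -/
  parts : List ℕ
  decreasing : parts.Pairwise (fun a b => b < a)
  positive : ∀ a ∈ parts, 0 < a

namespace StrictPartition

/-- The `i`-th part, with rows numbered from `0`, and with value `0` beyond the last part. -/
def part (lam : StrictPartition) (i : ℕ) : ℕ := lam.parts.getD i 0

/-- The size `|lam|`, the sum of the parts. -/
def size (lam : StrictPartition) : ℕ := lam.parts.sum

/-- The length `ℓ(lam)`, the number of parts. -/
def length (lam : StrictPartition) : ℕ := lam.parts.length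

/-- Containment: every part of the smaller one is at most the corresponding part of the larger. -/
instance : LE StrictPartition := ⟨fun mu lam => ∀ i, mu.part i ≤ lam.part i⟩

/-- The boxes of the shifted Young diagram. Rows and columns are numbered from `0`, and row `i`
occupies the columns `i + 1, …, i + part i` (so its leftmost box has content `1`). -/
def cells (lam : StrictPartition) : Finset (ℕ × ℕ) :=
  (Finset.range lam.length).biUnion fun i => {i} ×ˢ Finset.Ioc i (i + lam.part i)

/-- The boxes of the skew shifted Young diagram `lam / mu`. -/
def skewCells (lam mu : StrictPartition) : Finset (ℕ × ℕ) := lam.cells \ mu.cells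

/-- The hook length of a box `(i, j)` of the shifted Young diagram: the number of boxes to its
right, plus the number of boxes below it, plus one for the box itself, plus the `j`-th part. -/
def hookLength (lam : StrictPartition) (c : ℕ × ℕ) : ℕ :=
  (lam.cells.filter fun d => d.1 = c.1 ∧ c.2 < d.2).card
    + (lam.cells.filter fun d => d.2 = c.2 ∧ c.1 < d.1).card + 1 + lam.part c.2

/-- `H(lam)`, the product of the hook lengths of all boxes of the shifted Young diagram. -/
def hookProd (lam : StrictPartition) : ℕ := ∏ c ∈ lam.cells, lam.hookLength c

/-- The standard shifted Young tableaux of shape `lam / mu`: bijective fillings of the boxes by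
`{0, …, |lam / mu| - 1}` that increase along every row and down every column. -/
def StandardTableau (lam mu : StrictPartition) : Type :=
  {T : {c // c ∈ lam.skewCells mu} ≃ Fin (lam.skewCells mu).card //
    (∀ c d, c.1.1 = d.1.1 → c.1.2 < d.1.2 → T c < T d) ∧
    (∀ c d, c.1.2 = d.1.2 → c.1.1 < d.1.1 → T c < T d)}

/-- `f_{lam / mu}`, the number of standard shifted Young tableaux of shape `lam / mu`. -/
noncomputable def numTableaux (lam mu : StrictPartition) : ℕ :=
  Nat.card (StandardTableau lam mu)

theorem part_pos_iff (lam : StrictPartition) (i : ℕ) : 0 < lam.part i ↔ i < lam.length := by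
  unfold part length
  by_cases h : i < lam.parts.length
  · have := lam.positive _ (List.getElem_mem h)
    simp [h, this]
  · simp [h]

theorem part_lt (lam : StrictPartition) {i j : ℕ} (hij : i < j) (hj : 0 < lam.part j) :
    lam.part j < lam.part i := by
  have hj' : j < lam.parts.length := (lam.part_pos_iff j).1 hj
  have hi' : i < lam.parts.length := hij.trans hj'
  unfold part
  rw [List.getD_eq_getElem _ _ hj', List.getD_eq_getElem _ _ hi']
  exact List.pairwise_iff_getElem.1 lam.decreasing i j hi' hj' hij

theorem add_part_le (lam : StrictPartition) {i j : ℕ} (hij : i ≤ j) (hj : 0 < lam.part j) :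
    j + lam.part j ≤ i + lam.part i := by
  induction j, hij using Nat.le_induction with
  | base => exact le_rfl
  | succ k hk ih =>
    have h := lam.part_lt (Nat.lt_succ_self k) hj
    have := ih (by omega)
    simp only [Nat.succ_eq_add_one] at h
    omega

theorem mem_cells (lam : StrictPartition) (i j : ℕ) :
    (i, j) ∈ lam.cells ↔ i < j ∧ j ≤ i + lam.part i := by
  have := lam.part_pos_iff i
  simp only [cells, Finset.mem_biUnion, Finset.mem_range, Finset.mem_product,
    Finset.mem_singleton, Finset.mem_Ioc]
  constructor
  · rintro ⟨a, -, rfl, h⟩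
    exact h
  · intro h
    exact ⟨i, this.1 (by omega), rfl, h⟩

/-- The boxes of the doubled distinct partition: those of the shifted Young diagram, together
with `part j` boxes added at the bottom of column `j` (whose boxes in the shifted Young diagram
are in the rows `0, …, j - 1`), for each `j < length`. -/
def doubledCells (lam : StrictPartition) : Finset (ℕ × ℕ) :=
  lam.cells ∪
    (Finset.range lam.length).biUnion fun j => Finset.Ico j (j + lam.part j) ×ˢ {j}

theorem mem_doubledCells (lam : StrictPartition) (i j : ℕ) :
    (i, j) ∈ lam.doubledCells ↔
      (i < j ∧ j ≤ i + lam.part i) ∨ (j ≤ i ∧ i < j + lam.part j) := by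
  have := lam.part_pos_iff j
  simp only [doubledCells, Finset.mem_union, mem_cells, Finset.mem_biUnion, Finset.mem_range,
    Finset.mem_product, Finset.mem_singleton, Finset.mem_Ico]
  refine or_congr Iff.rfl ⟨?_, fun h => ⟨j, this.1 (by omega), h, rfl⟩⟩
  rintro ⟨a, -, h, rfl⟩
  exact h

/-- The doubled distinct partition of `lam`, as a usual Young diagram. -/
def doubled (lam : StrictPartition) : YoungDiagram where
  cells := lam.doubledCells
  isLowerSet := by
    rintro ⟨i, j⟩ ⟨i', j'⟩ hle hmem
    obtain ⟨hi, hj⟩ : i' ≤ i ∧ j' ≤ j := hle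
    simp only [Finset.mem_coe, mem_doubledCells] at hmem ⊢
    rcases hmem with h | h <;> rcases lt_or_ge i' j' with h' | h'
    · have := lam.add_part_le hi (by omega)
      omega
    · have := lam.add_part_le (h'.trans hi) (by omega)
      omega
    · have := lam.add_part_le (h'.le.trans hj) (by omega)
      omega
    · have := lam.add_part_le hj (by omega)
      omega

theorem finite_of_card_cells_le (N : ℕ) :
    {lam : StrictPartition | lam.cells.card ≤ N}.Finite := by
  have hinj : Function.Injective fun lam : StrictPartition => lam.parts.toFinset := by
    intro a b hab
    have nd : ∀ c : StrictPartition, c.parts.Nodup := fun c =>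
      c.decreasing.imp fun h => h.ne'
    have hp : a.parts.Perm b.parts := by
      refine (List.perm_ext_iff_of_nodup (nd a) (nd b)).2 fun x => ?_
      have := congrArg (fun s => x ∈ s) hab
      simpa using this
    ext1
    exact hp.eq_of_pairwise (fun x y _ _ h1 h2 => absurd h1 (Nat.lt_asymm h2))
      a.decreasing b.decreasing
  refine Set.Finite.of_injOn (f := fun lam : StrictPartition => lam.parts.toFinset)
    (t := ((Finset.range (N + 1)).powerset : Set (Finset ℕ))) ?_ hinj.injOn
    (Finset.finite_toSet _)
  intro lam hlam
  simp only [Finset.coe_powerset, Set.mem_preimage, Set.mem_powerset_iff, Finset.coe_subset]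
  intro x hx
  obtain ⟨i, hi, rfl⟩ := List.mem_iff_getElem.1 (List.mem_toFinset.1 hx)
  have hsub : {i} ×ˢ Finset.Ioc i (i + lam.part i) ⊆ lam.cells :=
    Finset.subset_biUnion_of_mem (fun i => {i} ×ˢ Finset.Ioc i (i + lam.part i))
      (Finset.mem_range.2 hi)
  have hcard := Finset.card_le_card hsub
  have hpart : lam.part i = lam.parts[i] := List.getD_eq_getElem _ _ hi
  have hN : lam.cells.card ≤ N := hlam
  simp only [Finset.card_product, Finset.card_singleton, Nat.card_Ioc] at hcard
  rw [Finset.mem_range]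
  omega

theorem finite_above (mu : StrictPartition) (n : ℕ) :
    {lam : StrictPartition | mu ≤ lam ∧ (lam.skewCells mu).card = n}.Finite := by
  refine (finite_of_card_cells_le (n + mu.cells.card)).subset ?_
  rintro lam ⟨-, h⟩
  have := Finset.le_card_sdiff mu.cells lam.cells
  simp only [skewCells] at h
  change lam.cells.card ≤ n + mu.cells.card
  omega

theorem finite_doubled (m : ℕ) : {lam : StrictPartition | lam.doubled.card = m}.Finite := by
  refine (finite_of_card_cells_le m).subset ?_
  intro lam h
  exact (Finset.card_le_card Finset.subset_union_left).trans_eq h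

/-- The finite set of strict partitions `lam ⊇ mu` such that `lam / mu` has `n` boxes. -/
noncomputable def above (mu : StrictPartition) (n : ℕ) : Finset StrictPartition :=
  (finite_above mu n).toFinset

/-- The finite set of strict partitions whose doubled distinct partition has size `m`. -/
noncomputable def withDoubledSize (m : ℕ) : Finset StrictPartition :=
  (finite_doubled m).toFinset

end StrictPartition

namespace YoungDiagram

/-- The hook length of a box of a Young diagram: arm length plus leg length plus one. -/
def boxHookLength (Y : YoungDiagram) (c : ℕ × ℕ) : ℕ :=
  (Y.rowLen c.1 - (c.2 + 1)) + (Y.colLen c.2 - (c.1 + 1)) + 1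

/-- `H(Y)`, the product of all hook lengths of a Young diagram. -/
def boxHookProd (Y : YoungDiagram) : ℕ := ∏ c ∈ Y.cells, Y.boxHookLength c

end YoungDiagram

/-- `p¹(lam)`: the sum of the squared hook lengths of the doubled distinct partition of `lam`. -/
def StrictPartition.p1 (lam : StrictPartition) : ℕ :=
  ∑ c ∈ lam.doubled.cells, lam.doubled.boxHookLength c ^ 2

/-!
The identity is proved by letting strict partitions grow one box at a time. Give `lam` the weight
`w(lam) = 2 ^ (|lam| - ℓ(lam)) / H(lam)`. Deleting the largest entry of a standard tableau
(`numTableaux_eq_sum`) turns the sum over `lam ⊇ mu` into an iterated sum over covers, so that it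
suffices to know, for each `nu`,

* `∑ w(lam) = w(nu)` over the covers `lam` of `nu` (`sum_above_one_weight`), and
* `∑ w(lam) (p¹(lam) - p¹(nu)) = (12 |nu| + 5) w(nu)` (`sum_above_one_weight_mul_p1`).

Let `x i` be the parts of `nu`, with one zero part appended, `y i = x i (x i + 1)` and
`z i = x i (x i - 1)`. The product formula `H = ∏ (x i)! ∏_{i < j} (x i + x j) / (x i - x j)`
(`hookProd_eq`) shows that a box added to row `r` multiplies the weight by
`∏_j (y r - z j) / ∏_{j ≠ r} (y r - y j)`, the first product being over the nonzero parts
(`weight_eq_weight_mul_transition`). This ratio vanishes exactly when row `r` cannot grow, so the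
sums over covers are sums over all rows. These are coefficients of Lagrange interpolation at the
nodes `y r`: the ratios add up to `1`, and weighted by `y r` they add up to
`∑ y j - ∑ z j = 2 |nu|`.

On the other side, the hook lengths of the doubled distinct partition are two copies of those of
the shifted diagram with each part `x` traded for `2 x`
(`prod_boxHookLength_doubled_mul_prod_part`), and in the shifted diagram the hook lengths together
with the differences of the parts are the sums of the parts together with the numbers up to each
part (`prod_hookLength_mul_prod_sub`). With squares this gives
`p¹ = 4 |lam|² + ∑ (2 x³ + x) / 3` (`p1_eq`), which grows by `8 |nu| + 2 y r + 5` when row `r`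
gains a box; with products it gives `H(doubled lam) = 2 ^ ℓ(lam) H(lam)²`.

The second identity is the first one for the empty partition, by the hook length formula
`f_lam = |lam|! / H(lam)` (`numTableaux_empty_mul_hookProd`). That formula follows in the same way
from the interpolation identity at the nodes `z r`, which govern the removal of a box.
-/

/-! ### Strict partitions as sequences of parts -/

namespace StrictPartition

theorem part_eq_zero_iff (lam : StrictPartition) (i : ℕ) : lam.part i = 0 ↔ lam.length ≤ i := by
  have := lam.part_pos_iff i
  omega

theorem part_eq_zero (lam : StrictPartition) {i : ℕ} (h : lam.length ≤ i) : lam.part i = 0 :=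
  (lam.part_eq_zero_iff i).2 h

theorem part_injective : Function.Injective part := by
  intro a b h
  have hlen : a.length = b.length := by
    have h1 := a.part_pos_iff b.length
    have h2 := b.part_pos_iff a.length
    rw [h, b.part_pos_iff] at h1
    rw [← h, a.part_pos_iff] at h2
    omega
  ext1
  refine List.ext_getElem hlen fun i hi hi' => ?_
  have := congrFun h i
  rwa [part, part, List.getD_eq_getElem _ _ hi, List.getD_eq_getElem _ _ hi'] at this

/-- A finitely supported sequence that decreases strictly as long as it is positive is the
sequence of parts of a strict partition. -/
theorem exists_part_eq (f : ℕ → ℕ) (N : ℕ) (hN : ∀ i, N ≤ i → f i = 0)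
    (hf : ∀ i, 0 < f (i + 1) → f (i + 1) < f i) : ∃ lam : StrictPartition, lam.part = f := by
  induction N generalizing f with
  | zero => exact ⟨⟨[], by simp, by simp⟩, by funext i; simp [part, hN]⟩
  | succ N ih =>
    obtain ⟨lam, hlam⟩ := ih (fun i => f (i + 1)) (fun i hi => hN _ (by omega))
      (fun i h => hf _ h)
    rcases Nat.eq_zero_or_pos (f 0) with h0 | h0
    · have hz : ∀ i, f i = 0 := by
        intro i
        induction i with
        | zero => exact h0
        | succ i ih => have := hf i; omega
      exact ⟨⟨[], by simp, by simp⟩, by funext i; simp [part, hz]⟩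
    · have hlt : ∀ i, f (i + 1) < f 0 := by
        intro i
        induction i with
        | zero => have := hf 0; omega
        | succ i ih => have := hf (i + 1); omega
      refine ⟨⟨f 0 :: lam.parts, List.pairwise_cons.2 ⟨fun a ha => ?_, lam.decreasing⟩, ?_⟩, ?_⟩
      · obtain ⟨i, hi, rfl⟩ := List.mem_iff_getElem.1 ha
        have := congrFun hlam i
        rw [part, List.getD_eq_getElem _ _ hi] at this
        rw [this]
        exact hlt i
      · intro a ha
        rcases List.mem_cons.1 ha with rfl | ha
        · exact h0
        · exact lam.positive a ha
      · funext i
        cases i with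
        | zero => simp [part]
        | succ i => simpa [part] using congrFun hlam i

theorem size_eq_sum (lam : StrictPartition) {N : ℕ} (hN : lam.length ≤ N) :
    lam.size = ∑ i ∈ Finset.range N, lam.part i := by
  have h1 : lam.size = ∑ i ∈ Finset.range lam.length, lam.part i := by
    rw [size, length, ← Fin.sum_univ_eq_sum_range, ← List.sum_ofFn]
    congr 1
    refine List.ext_getElem (by simp) fun i hi hi' => ?_
    simp [part]
  rw [h1]
  refine Finset.sum_subset (by simpa using hN) fun i _ hi => ?_
  exact lam.part_eq_zero (by simpa using hi)

theorem card_cells (lam : StrictPartition) : lam.cells.card = lam.size := by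
  rw [cells, Finset.card_biUnion, lam.size_eq_sum le_rfl]
  · simp
  · intro i _ j _ hij
    rw [Function.onFun, Finset.disjoint_left]
    rintro ⟨a, b⟩ h1 h2
    simp only [Finset.mem_product, Finset.mem_singleton] at h1 h2
    exact hij (h1.1.symm.trans h2.1)

theorem cells_subset_iff {mu lam : StrictPartition} : mu.cells ⊆ lam.cells ↔ mu ≤ lam := by
  constructor
  · intro h i
    by_contra hlt
    have := h ((mu.mem_cells i (i + mu.part i)).2 (by omega))
    rw [mem_cells] at this
    omega
  · rintro h ⟨i, j⟩ hc
    rw [mem_cells] at hc ⊢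
    have := h i
    omega

theorem le_refl (mu : StrictPartition) : mu ≤ mu := fun _ => le_rfl

theorem le_trans {mu nu lam : StrictPartition} (h : mu ≤ nu) (h' : nu ≤ lam) : mu ≤ lam :=
  fun i => (h i).trans (h' i)

theorem card_skewCells {mu lam : StrictPartition} (h : mu ≤ lam) :
    (lam.skewCells mu).card + mu.size = lam.size := by
  rw [skewCells, ← mu.card_cells, ← lam.card_cells]
  exact Finset.card_sdiff_add_card_eq_card (cells_subset_iff.2 h)

theorem mem_above {mu lam : StrictPartition} {n : ℕ} :
    lam ∈ above mu n ↔ mu ≤ lam ∧ lam.size = mu.size + n := by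
  simp only [above, Set.Finite.mem_toFinset, Set.mem_ofPred_eq]
  refine and_congr_right fun h => ?_
  have := card_skewCells h
  omega

/-- The strict partitions covering `nu` are those obtained by enlarging one part, possibly the
zero part just after the last one, by one. -/
theorem mem_above_one {nu lam : StrictPartition} :
    lam ∈ above nu 1 ↔
      ∃ r, lam.part = Function.update nu.part r (nu.part r + 1) := by
  rw [mem_above]
  constructor
  · rintro ⟨hle, hs⟩
    obtain ⟨N, h1, h2⟩ : ∃ N, nu.length ≤ N ∧ lam.length ≤ N :=
      ⟨_, le_max_left _ _, le_max_right _ _⟩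
    rw [nu.size_eq_sum h1, lam.size_eq_sum h2] at hs
    obtain ⟨r, hr, hlt⟩ : ∃ r ∈ Finset.range N, nu.part r < lam.part r := by
      by_contra! hcon
      have := Finset.sum_le_sum hcon
      omega
    refine ⟨r, funext fun i => ?_⟩
    rw [← Finset.add_sum_erase _ _ hr, ← Finset.add_sum_erase _ _ hr] at hs
    have hrest : ∑ i ∈ (Finset.range N).erase r, nu.part i
        ≤ ∑ i ∈ (Finset.range N).erase r, lam.part i := Finset.sum_le_sum fun i _ => hle i
    rcases eq_or_ne i r with rfl | hir
    · rw [Function.update_self]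
      omega
    · rw [Function.update_of_ne hir]
      rcases lt_or_ge i N with hi | hi
      · refine ((Finset.sum_eq_sum_iff_of_le fun i _ => hle i).1 (?_ : _ = _) i
          (Finset.mem_erase.2 ⟨hir, Finset.mem_range.2 hi⟩)).symm
        omega
      · rw [lam.part_eq_zero (h2.trans hi), nu.part_eq_zero (h1.trans hi)]
  · rintro ⟨r, hr⟩
    have hle : nu ≤ lam := by
      intro i
      rw [hr]
      rcases eq_or_ne i r with rfl | hir
      · simp
      · simp [hir]
    refine ⟨hle, ?_⟩
    obtain ⟨N, h1, h2, h3⟩ : ∃ N, nu.length ≤ N ∧ lam.length ≤ N ∧ r < N :=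
      ⟨max (max nu.length lam.length) (r + 1), by omega, by omega, by omega⟩
    rw [nu.size_eq_sum h1, lam.size_eq_sum h2, hr,
      Finset.sum_update_of_mem (Finset.mem_range.2 h3), ← Finset.erase_eq,
      ← Finset.add_sum_erase _ nu.part (Finset.mem_range.2 h3)]
    omega

theorem row_unique_of_part_eq_update {nu lam : StrictPartition} {r s : ℕ}
    (hr : lam.part = Function.update nu.part r (nu.part r + 1))
    (hs : lam.part = Function.update nu.part s (nu.part s + 1)) : r = s := by
  by_contra hne
  have h := congrFun (hr.symm.trans hs) r
  rw [Function.update_self, Function.update_of_ne hne] at h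
  omega

theorem eq_of_part_eq_update {nu nu' lam : StrictPartition} {r : ℕ}
    (h : lam.part = Function.update nu.part r (nu.part r + 1))
    (h' : lam.part = Function.update nu'.part r (nu'.part r + 1)) : nu = nu' := by
  refine part_injective (funext fun i => ?_)
  have h2 := congrFun (h.symm.trans h') i
  rcases eq_or_ne i r with rfl | hi
  · rw [Function.update_self, Function.update_self] at h2
    omega
  · rwa [Function.update_of_ne hi, Function.update_of_ne hi] at h2

/-- The row that grows in a cover is at most the first empty row. -/
theorem le_length_of_part_eq_update {nu lam : StrictPartition} {r : ℕ}
    (h : lam.part = Function.update nu.part r (nu.part r + 1)) : r ≤ nu.length := by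
  by_contra! hr
  have h1 : lam.part r = nu.part r + 1 := by rw [h, Function.update_self]
  have h2 : lam.part nu.length = nu.part nu.length := by rw [h, Function.update_of_ne hr.ne]
  have h3 := lam.part_lt hr (by omega)
  rw [h2, nu.part_eq_zero le_rfl] at h3
  omega

theorem lt_length_of_part_eq_update {nu lam : StrictPartition} {r : ℕ}
    (h : lam.part = Function.update nu.part r (nu.part r + 1)) : r < lam.length := by
  rw [← part_pos_iff, h, Function.update_self]
  omega

theorem length_of_part_eq_update {nu lam : StrictPartition} {r : ℕ}
    (h : lam.part = Function.update nu.part r (nu.part r + 1)) :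
    lam.length = if r < nu.length then nu.length else nu.length + 1 := by
  have hr := le_length_of_part_eq_update h
  have hr' := lt_length_of_part_eq_update h
  have key : ∀ i, i < lam.length ↔ i < nu.length ∨ i = r := by
    intro i
    rw [← part_pos_iff, ← part_pos_iff, h]
    rcases eq_or_ne i r with rfl | hir
    · simp
    · simp [hir]
  have h1 := key nu.length
  have h2 := key (nu.length - 1)
  have h3 := key (nu.length + 1)
  split_ifs <;> omega

/-- Enlarging row `r` gives a strict partition unless the previous row is exactly one longer. -/
theorem exists_part_eq_update (nu : StrictPartition) {r : ℕ} (hr : r ≤ nu.length)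
    (h : ∀ i < nu.length, nu.part i ≠ nu.part r + 1) :
    ∃ lam : StrictPartition, lam.part = Function.update nu.part r (nu.part r + 1) := by
  refine exists_part_eq _ (nu.length + 1) (fun i hi => ?_) fun i => ?_
  · rw [Function.update_of_ne (by omega)]
    exact nu.part_eq_zero (by omega)
  · rcases eq_or_ne (i + 1) r with rfl | h1
    · rw [Function.update_self, Function.update_of_ne (by omega)]
      have h2 := h i (by omega)
      have h3 := nu.part_lt (Nat.lt_succ_self i)
      have h4 := nu.part_pos_iff i
      simp only [Nat.succ_eq_add_one] at h3
      omega
    · rw [Function.update_of_ne h1]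
      intro h0
      have h3 := nu.part_lt (Nat.lt_succ_self i) h0
      simp only [Nat.succ_eq_add_one] at h3
      rcases eq_or_ne i r with rfl | h2
      · rw [Function.update_self]
        omega
      · rwa [Function.update_of_ne h2]

/-- Shortening row `r` gives a strict partition unless the next row is exactly one shorter. -/
theorem exists_update_eq_part (lam : StrictPartition) {r : ℕ} (hr : r < lam.length)
    (h : ∀ i < lam.length, lam.part i + 1 ≠ lam.part r) :
    ∃ nu : StrictPartition, lam.part = Function.update nu.part r (nu.part r + 1) := by
  have hpos := (lam.part_pos_iff r).2 hr
  obtain ⟨nu, hnu⟩ := exists_part_eq (Function.update lam.part r (lam.part r - 1)) lam.length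
    (fun i hi => by
      rw [Function.update_of_ne (by omega)]
      exact lam.part_eq_zero hi) (fun i => by
      have h3 := lam.part_lt (Nat.lt_succ_self i)
      simp only [Nat.succ_eq_add_one] at h3
      rcases eq_or_ne (i + 1) r with rfl | h1
      · rw [Function.update_self, Function.update_of_ne (by omega)]
        omega
      · rw [Function.update_of_ne h1]
        intro h0
        rcases eq_or_ne i r with rfl | h2
        · rw [Function.update_self]
          have := h (i + 1) ((lam.part_pos_iff _).1 h0)
          have := h3 h0
          omega
        · rw [Function.update_of_ne h2]
          exact h3 h0)
  refine ⟨nu, ?_⟩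
  rw [hnu, Function.update_self, Function.update_idem, Nat.sub_add_cancel hpos,
    Function.update_eq_self]

end StrictPartition

/-! ### Coefficients of Lagrange interpolation -/

open Polynomial in
/-- Evaluating the polynomial `∏ (X - w k)`, whose degree is one less than the number of nodes,
by Lagrange interpolation: its leading coefficient is `1`. -/
theorem sum_prod_sub_div_prod_sub_eq_one {ι κ F : Type*} [DecidableEq ι] [Field F]
    {s : Finset ι} {t : Finset κ} {y : ι → F} {w : κ → F} (hy : Set.InjOn y s)
    (h : s.card = t.card + 1) :
    ∑ i ∈ s, (∏ k ∈ t, (y i - w k)) / ∏ j ∈ s.erase i, (y i - y j) = 1 := by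
  have h1 := Lagrange.leadingCoeff_eq_sum hy (P := Lagrange.nodal t w)
    (by rw [Lagrange.degree_nodal, h]; simp)
  rw [Lagrange.nodal_monic.leadingCoeff] at h1
  simpa only [Lagrange.eval_nodal] using h1.symm

open Polynomial in
/-- With as many zeros `w k` as nodes `y i`, the polynomial `∏ (X - w k) - ∏ (X - y i)` takes the
same values at the nodes as `∏ (X - w k)` and has degree less than the number of nodes; its top
coefficient is read off by Vieta's formula. -/
theorem sum_prod_sub_div_prod_sub_eq_sub {ι κ F : Type*} [DecidableEq ι] [Field F]
    {s : Finset ι} {t : Finset κ} {y : ι → F} {w : κ → F} (hy : Set.InjOn y s)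
    (h : s.card = t.card) :
    ∑ i ∈ s, (∏ k ∈ t, (y i - w k)) / ∏ j ∈ s.erase i, (y i - y j)
      = ∑ i ∈ s, y i - ∑ k ∈ t, w k := by
  rcases s.eq_empty_or_nonempty with rfl | hs
  · have : t = ∅ := by simpa using h.symm
    simp [this]
  have hpos := hs.card_pos
  have hdeg : (Lagrange.nodal t w - Lagrange.nodal s y).degree < s.card := by
    have h1 := Polynomial.degree_sub_lt_left (p := Lagrange.nodal t w) (q := Lagrange.nodal s y)
      (by rw [Lagrange.degree_nodal, Lagrange.degree_nodal, h]) Lagrange.nodal_ne_zero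
      (by rw [Lagrange.nodal_monic.leadingCoeff, Lagrange.nodal_monic.leadingCoeff])
    rwa [Lagrange.degree_nodal, ← h] at h1
  have h1 := Lagrange.coeff_eq_sum hy hdeg
  have h2 : (Lagrange.nodal t w).coeff (s.card - 1) = -∑ k ∈ t, w k := by
    rw [← prod_X_sub_C_nextCoeff, nextCoeff_of_natDegree_pos, ← Lagrange.nodal_eq,
      Lagrange.natDegree_nodal, h]
    rw [← Lagrange.nodal_eq, Lagrange.natDegree_nodal]
    omega
  have h3 : (Lagrange.nodal s y).coeff (s.card - 1) = -∑ k ∈ s, y k := by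
    rw [← prod_X_sub_C_nextCoeff, nextCoeff_of_natDegree_pos, ← Lagrange.nodal_eq,
      Lagrange.natDegree_nodal]
    rw [← Lagrange.nodal_eq, Lagrange.natDegree_nodal]
    omega
  rw [coeff_sub, h2, h3] at h1
  have h4 : ∑ i ∈ s, (∏ k ∈ t, (y i - w k)) / ∏ j ∈ s.erase i, (y i - y j)
      = ∑ i ∈ s, ((Lagrange.nodal t w - Lagrange.nodal s y).eval (y i))
          / ∏ j ∈ s.erase i, (y i - y j) := by
    refine Finset.sum_congr rfl fun i hi => ?_
    rw [eval_sub, Lagrange.eval_nodal_at_node hi, sub_zero, Lagrange.eval_nodal]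
  rw [h4, ← h1]
  ring

/-! ### Products over pairs -/

/-- A product over pairs `i < j` of factors that are trivial away from the index `r` is a product
over the indices other than `r`. -/
theorem prod_range_prod_Ioo_eq_prod_erase {M : Type*} [CommMonoid M] {N r : ℕ} (hr : r < N)
    (ψ : ℕ → ℕ → M) (hsymm : ∀ i j, ψ i j = ψ j i)
    (h1 : ∀ i j, i < j → j < N → i ≠ r → j ≠ r → ψ i j = 1) :
    ∏ i ∈ Finset.range N, ∏ j ∈ Finset.Ioo i N, ψ i j
      = ∏ j ∈ (Finset.range N).erase r, ψ r j := by
  have hinner : ∀ i ∈ (Finset.range N).erase r,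
      ∏ j ∈ Finset.Ioo i N, ψ i j = if i < r then ψ r i else 1 := by
    intro i hi
    have hir := (Finset.mem_erase.1 hi).1
    split_ifs with hlt
    · rw [Finset.prod_eq_single r, hsymm]
      · intro j hj hjr
        rw [Finset.mem_Ioo] at hj
        exact h1 i j hj.1 hj.2 hir hjr
      · intro hn
        exact absurd (Finset.mem_Ioo.2 ⟨hlt, hr⟩) hn
    · refine Finset.prod_eq_one fun j hj => ?_
      rw [Finset.mem_Ioo] at hj
      exact h1 i j hj.1 hj.2 hir (by omega)
  have hsplit : ∏ j ∈ Finset.Ioo r N, ψ r j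
      = ∏ j ∈ (Finset.range N).erase r, if j < r then 1 else ψ r j := by
    rw [Finset.prod_ite, Finset.prod_const_one, one_mul]
    refine Finset.prod_congr ?_ fun _ _ => rfl
    ext j
    simp only [Finset.mem_Ioo, Finset.mem_filter, Finset.mem_erase, Finset.mem_range]
    omega
  rw [← Finset.mul_prod_erase _ _ (Finset.mem_range.2 hr), Finset.prod_congr rfl hinner, hsplit,
    ← Finset.prod_mul_distrib]
  refine Finset.prod_congr rfl fun j _ => ?_
  split_ifs <;> simp

/-- A symmetric product over all pairs is the product over the diagonal times the square of the
product over the pairs `i < j`. -/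
@[to_additive]
theorem prod_range_prod_range_symm {M : Type*} [CommMonoid M] (N : ℕ) (φ : ℕ → ℕ → M)
    (hsymm : ∀ i j, φ i j = φ j i) :
    ∏ i ∈ Finset.range N, ∏ j ∈ Finset.range N, φ i j
      = (∏ i ∈ Finset.range N, φ i i) *
        ((∏ i ∈ Finset.range N, ∏ j ∈ Finset.Ioo i N, φ i j) *
          ∏ i ∈ Finset.range N, ∏ j ∈ Finset.Ioo i N, φ i j) := by
  have hlow : ∏ i ∈ Finset.range N, ∏ j ∈ Finset.range i, φ i j
      = ∏ i ∈ Finset.range N, ∏ j ∈ Finset.Ioo i N, φ i j := by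
    rw [Finset.prod_comm' (s' := fun j => Finset.Ioo j N) (t' := Finset.range N)]
    · exact Finset.prod_congr rfl fun i _ => Finset.prod_congr rfl fun j _ => hsymm _ _
    · intro i j
      simp only [Finset.mem_range, Finset.mem_Ioo]
      omega
  nth_rewrite 1 [← hlow]
  rw [← Finset.prod_mul_distrib, ← Finset.prod_mul_distrib]
  refine Finset.prod_congr rfl fun i hi => ?_
  have hi := Finset.mem_range.1 hi
  have h1 : Finset.range N = insert i (Finset.range i ∪ Finset.Ioo i N) := by
    ext j
    simp only [Finset.mem_range, Finset.mem_insert, Finset.mem_union, Finset.mem_Ioo]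
    omega
  rw [h1, Finset.prod_insert, Finset.prod_union]
  · rw [Finset.disjoint_left]
    intro j hj
    simp only [Finset.mem_range, Finset.mem_Ioo] at hj ⊢
    omega
  · simp

/-! ### Hook lengths of shifted and doubled diagrams -/

namespace StrictPartition

/-- The number of rows below row `i` of the shifted diagram that reach column `j`, for a column
`j ≥ length`. -/
def legCount (lam : StrictPartition) (i j : ℕ) : ℕ :=
  ((Finset.Ioo i lam.length).filter fun k => j ≤ k + lam.part k).card

/-- The hook length of the box `(i, j)` of the shifted diagram, for a column `j ≥ length`. -/
def tailHook (lam : StrictPartition) (i j : ℕ) : ℕ :=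
  i + lam.part i - j + lam.legCount i j + 1

theorem legCount_le (lam : StrictPartition) (i j : ℕ) :
    lam.legCount i j ≤ lam.length - i - 1 := by
  simpa [legCount] using Finset.card_filter_le (Finset.Ioo i lam.length) _

theorem legCount_anti (lam : StrictPartition) (i : ℕ) {j j' : ℕ} (h : j ≤ j') :
    lam.legCount i j' ≤ lam.legCount i j := by
  refine Finset.card_le_card fun k hk => ?_
  rw [Finset.mem_filter] at hk ⊢
  exact ⟨hk.1, h.trans hk.2⟩

theorem le_legCount (lam : StrictPartition) {i j k : ℕ} (hk : k < lam.length)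
    (h : j ≤ k + lam.part k) : k - i ≤ lam.legCount i j := by
  rw [← Nat.card_Ioc, legCount]
  refine Finset.card_le_card fun m hm => ?_
  rw [Finset.mem_Ioc] at hm
  rw [Finset.mem_filter, Finset.mem_Ioo]
  have := lam.add_part_le hm.2 ((lam.part_pos_iff k).2 hk)
  omega

theorem legCount_le_of_lt (lam : StrictPartition) {i j k : ℕ}
    (h : k + lam.part k < j) : lam.legCount i j ≤ k - i - 1 := by
  rw [← Nat.card_Ioo, legCount]
  refine Finset.card_le_card fun m hm => ?_
  rw [Finset.mem_filter, Finset.mem_Ioo] at hm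
  rw [Finset.mem_Ioo]
  refine ⟨hm.1.1, ?_⟩
  by_contra! hkm
  have := lam.add_part_le hkm ((lam.part_pos_iff m).2 hm.1.2)
  omega

theorem length_le_add_part (lam : StrictPartition) {i : ℕ} (hi : i < lam.length) :
    lam.length ≤ i + lam.part i := by
  have h := lam.add_part_le (i := i) (j := lam.length - 1) (by omega)
    ((lam.part_pos_iff _).2 (by omega))
  have := (lam.part_pos_iff (lam.length - 1)).2 (by omega)
  omega

/-- In row `i`, the hook lengths in the columns `j ≥ length` and the differences `part i - part k`
for `k > i` fill up `1, …, part i`. -/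
@[to_additive]
theorem prod_tailHook_mul_prod_sub {M : Type*} [CommMonoid M] (lam : StrictPartition) (g : ℕ → M)
    {i : ℕ} (hi : i < lam.length) :
    (∏ j ∈ Finset.Icc lam.length (i + lam.part i), g (lam.tailHook i j)) *
        ∏ k ∈ Finset.Ioo i lam.length, g (lam.part i - lam.part k)
      = ∏ t ∈ Finset.Icc 1 (lam.part i), g t := by
  have hlen := lam.length_le_add_part hi
  have hpart : ∀ k ∈ Finset.Ioo i lam.length, 0 < lam.part k ∧ lam.part k < lam.part i := by
    intro k hk
    rw [Finset.mem_Ioo] at hk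
    have h := (lam.part_pos_iff k).2 hk.2
    exact ⟨h, lam.part_lt hk.1 h⟩
  have inj1 : Set.InjOn (lam.tailHook i)
      (Finset.Icc lam.length (i + lam.part i) : Finset ℕ) := by
    have key : ∀ j j', j < j' → j' ≤ i + lam.part i → lam.tailHook i j' < lam.tailHook i j := by
      intro j j' h h'
      have := lam.legCount_anti i h.le
      simp only [tailHook]
      omega
    intro j hj j' hj' h
    simp only [Finset.coe_Icc, Set.mem_Icc] at hj hj'
    rcases lt_trichotomy j j' with hlt | heq | hlt
    · have := key _ _ hlt hj'.2
      omega
    · exact heq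
    · have := key _ _ hlt hj.2
      omega
  have inj2 : Set.InjOn (fun k => lam.part i - lam.part k)
      (Finset.Ioo i lam.length : Finset ℕ) := by
    intro k hk k' hk' h
    have h1 := hpart k hk
    have h2 := hpart k' hk'
    simp only at h
    rcases lt_trichotomy k k' with hlt | heq | hlt
    · have := lam.part_lt hlt h2.1
      omega
    · exact heq
    · have := lam.part_lt hlt h1.1
      omega
  have hdisj : Disjoint ((Finset.Icc lam.length (i + lam.part i)).image (lam.tailHook i))
      ((Finset.Ioo i lam.length).image fun k => lam.part i - lam.part k) := by
    rw [Finset.disjoint_left]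
    intro a ha hb
    obtain ⟨j, hj, rfl⟩ := Finset.mem_image.1 ha
    obtain ⟨k, hk, h⟩ := Finset.mem_image.1 hb
    have h1 := hpart k hk
    rw [Finset.mem_Icc] at hj
    rw [Finset.mem_Ioo] at hk
    simp only [tailHook] at h
    rcases le_or_gt j (k + lam.part k) with hjk | hjk
    · have := lam.le_legCount (i := i) hk.2 hjk
      omega
    · have := lam.legCount_le_of_lt (i := i) hjk
      omega
  have hunion : (Finset.Icc lam.length (i + lam.part i)).image (lam.tailHook i) ∪
      (Finset.Ioo i lam.length).image (fun k => lam.part i - lam.part k)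
        = Finset.Icc 1 (lam.part i) := by
    refine Finset.eq_of_subset_of_card_le ?_ ?_
    · intro a ha
      rw [Finset.mem_Icc]
      rcases Finset.mem_union.1 ha with ha | ha
      · obtain ⟨j, hj, rfl⟩ := Finset.mem_image.1 ha
        rw [Finset.mem_Icc] at hj
        have := lam.legCount_le i j
        simp only [tailHook]
        omega
      · obtain ⟨k, hk, rfl⟩ := Finset.mem_image.1 ha
        have h1 := hpart k hk
        omega
    · rw [Finset.card_union_of_disjoint hdisj, Finset.card_image_of_injOn inj1,
        Finset.card_image_of_injOn inj2]
      simp only [Nat.card_Icc, Nat.card_Ioo]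
      omega
  rw [← hunion, Finset.prod_union hdisj, Finset.prod_image inj1, Finset.prod_image inj2]

theorem card_filter_right (lam : StrictPartition) (i j : ℕ) (hij : i ≤ j) :
    (lam.cells.filter fun d => d.1 = i ∧ j < d.2).card = i + lam.part i - j := by
  have h : (lam.cells.filter fun d => d.1 = i ∧ j < d.2)
      = {i} ×ˢ Finset.Ioc j (i + lam.part i) := by
    ext ⟨a, b⟩
    simp only [Finset.mem_filter, mem_cells, Finset.mem_product, Finset.mem_singleton,
      Finset.mem_Ioc]
    constructor
    · rintro ⟨h, rfl, h'⟩
      omega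
    · rintro ⟨rfl, h⟩
      omega
  rw [h, Finset.card_product, Finset.card_singleton, Nat.card_Ioc, one_mul]

theorem card_filter_below (lam : StrictPartition) (i j : ℕ) :
    (lam.cells.filter fun d => d.2 = j ∧ i < d.1).card
      = ((Finset.Ioo i j).filter fun k => j ≤ k + lam.part k).card := by
  have h : (lam.cells.filter fun d => d.2 = j ∧ i < d.1)
      = ((Finset.Ioo i j).filter fun k => j ≤ k + lam.part k).image fun k => (k, j) := by
    ext ⟨a, b⟩
    simp only [Finset.mem_filter, mem_cells, Finset.mem_image, Finset.mem_Ioo,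
      Prod.mk.injEq]
    constructor
    · rintro ⟨h, rfl, h'⟩
      exact ⟨a, ⟨by omega, by omega⟩, rfl, rfl⟩
    · rintro ⟨k, h, rfl, rfl⟩
      omega
  rw [h, Finset.card_image_of_injective _ fun a b h => (Prod.ext_iff.1 h).1]

theorem hookLength_of_lt_length (lam : StrictPartition) {i j : ℕ} (hij : i < j)
    (hj : j < lam.length) : lam.hookLength (i, j) = lam.part i + lam.part j := by
  have h1 := lam.add_part_le hij.le ((lam.part_pos_iff j).2 hj)
  have h2 : (Finset.Ioo i j).filter (fun k => j ≤ k + lam.part k) = Finset.Ioo i j := by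
    refine Finset.filter_true_of_mem fun k hk => ?_
    rw [Finset.mem_Ioo] at hk
    have := lam.add_part_le hk.2.le ((lam.part_pos_iff j).2 hj)
    omega
  simp only [hookLength]
  rw [card_filter_right _ _ _ hij.le, card_filter_below, h2, Nat.card_Ioo]
  omega

theorem hookLength_of_length_le (lam : StrictPartition) {i j : ℕ} (hi : i < lam.length)
    (hj : lam.length ≤ j) : lam.hookLength (i, j) = lam.tailHook i j := by
  have h2 : (Finset.Ioo i j).filter (fun k => j ≤ k + lam.part k)
      = (Finset.Ioo i lam.length).filter fun k => j ≤ k + lam.part k := by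
    ext k
    have := lam.part_pos_iff k
    simp only [Finset.mem_filter, Finset.mem_Ioo]
    omega
  simp only [hookLength]
  rw [card_filter_right _ _ _ (hi.le.trans hj), card_filter_below, h2, lam.part_eq_zero hj,
    tailHook, legCount]

/-- The hook lengths of the shifted diagram are the sums `part i + part j` for `i < j < length`
and the hook lengths in the columns `j ≥ length`. -/
@[to_additive]
theorem prod_hookLength {M : Type*} [CommMonoid M] (lam : StrictPartition) (g : ℕ → M) :
    ∏ c ∈ lam.cells, g (lam.hookLength c)
      = (∏ i ∈ Finset.range lam.length, ∏ j ∈ Finset.Ioo i lam.length,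
          g (lam.part i + lam.part j)) *
        ∏ i ∈ Finset.range lam.length, ∏ j ∈ Finset.Icc lam.length (i + lam.part i),
          g (lam.tailHook i j) := by
  rw [Finset.prod_finset_product lam.cells (Finset.range lam.length)
    (fun i => Finset.Ioc i (i + lam.part i)), ← Finset.prod_mul_distrib]
  · refine Finset.prod_congr rfl fun i hi => ?_
    rw [Finset.mem_range] at hi
    have hlen := lam.length_le_add_part hi
    have hU : Finset.Ioc i (i + lam.part i)
        = Finset.Ioo i lam.length ∪ Finset.Icc lam.length (i + lam.part i) := by
      ext j
      simp only [Finset.mem_union, Finset.mem_Ioc, Finset.mem_Ioo, Finset.mem_Icc]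
      omega
    rw [hU, Finset.prod_union]
    · congr 1
      · refine Finset.prod_congr rfl fun j hj => ?_
        rw [Finset.mem_Ioo] at hj
        rw [hookLength_of_lt_length _ hj.1 hj.2]
      · refine Finset.prod_congr rfl fun j hj => ?_
        rw [hookLength_of_length_le _ hi (Finset.mem_Icc.1 hj).1]
    · rw [Finset.disjoint_left]
      intro j h1 h2
      rw [Finset.mem_Ioo] at h1
      rw [Finset.mem_Icc] at h2
      omega
  · rintro ⟨i, j⟩
    have := lam.part_pos_iff i
    simp only [mem_cells, Finset.mem_range, Finset.mem_Ioc]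
    omega

theorem mem_doubled (lam : StrictPartition) (i j : ℕ) :
    (i, j) ∈ lam.doubled ↔ (i < j ∧ j ≤ i + lam.part i) ∨ (j ≤ i ∧ i < j + lam.part j) :=
  lam.mem_doubledCells i j

theorem doubled_rowLen_of_lt (lam : StrictPartition) {i : ℕ} (hi : i < lam.length) :
    lam.doubled.rowLen i = i + lam.part i + 1 := by
  have key : ∀ j, j < lam.doubled.rowLen i ↔ j < i + lam.part i + 1 := by
    intro j
    rw [← YoungDiagram.mem_iff_lt_rowLen, mem_doubled]
    rcases lt_or_ge i j with h | h
    · omega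
    · have := lam.add_part_le h ((lam.part_pos_iff i).2 hi)
      have := (lam.part_pos_iff i).2 hi
      omega
  exact eq_of_forall_lt_iff key

theorem doubled_colLen_of_lt (lam : StrictPartition) {j : ℕ} (hj : j < lam.length) :
    lam.doubled.colLen j = j + lam.part j := by
  have key : ∀ i, i < lam.doubled.colLen j ↔ i < j + lam.part j := by
    intro i
    rw [← YoungDiagram.mem_iff_lt_colLen, mem_doubled]
    rcases lt_or_ge i j with h | h
    · have := lam.add_part_le h.le ((lam.part_pos_iff j).2 hj)
      have := (lam.part_pos_iff j).2 hj
      omega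
    · omega
  exact eq_of_forall_lt_iff key

theorem card_filter_range_eq (lam : StrictPartition) {i j : ℕ} (hi : i < lam.length)
    (h : j ≤ i + lam.part i) :
    ((Finset.range lam.length).filter fun k => j ≤ k + lam.part k).card
      = i + 1 + lam.legCount i j := by
  have hU : (Finset.range lam.length).filter (fun k => j ≤ k + lam.part k)
      = Finset.range (i + 1) ∪ (Finset.Ioo i lam.length).filter fun k => j ≤ k + lam.part k := by
    ext k
    simp only [Finset.mem_filter, Finset.mem_range, Finset.mem_union, Finset.mem_Ioo]
    rcases le_or_gt k i with hk | hk
    · have := lam.add_part_le hk ((lam.part_pos_iff i).2 hi)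
      omega
    · omega
  rw [hU, Finset.card_union_of_disjoint, Finset.card_range, legCount]
  rw [Finset.disjoint_left]
  intro k h1 h2
  simp only [Finset.mem_filter, Finset.mem_range, Finset.mem_Ioo] at h1 h2
  omega

theorem doubled_colLen_of_le (lam : StrictPartition) {i j : ℕ} (hi : i < lam.length)
    (hj : lam.length ≤ j) (h : j ≤ i + lam.part i) :
    lam.doubled.colLen j = i + 1 + lam.legCount i j := by
  have hcol : lam.doubled.col j
      = ((Finset.range lam.length).filter fun k => j ≤ k + lam.part k).image fun k => (k, j) := by
    ext ⟨a, b⟩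
    have := lam.part_pos_iff a
    have := lam.part_pos_iff j
    simp only [YoungDiagram.mem_col_iff, mem_doubled, Finset.mem_image, Finset.mem_filter,
      Finset.mem_range, Prod.mk.injEq]
    constructor
    · rintro ⟨h1, rfl⟩
      exact ⟨a, by omega, rfl, rfl⟩
    · rintro ⟨k, h1, rfl, rfl⟩
      omega
  rw [← lam.card_filter_range_eq hi h, YoungDiagram.colLen_eq_card, hcol,
    Finset.card_image_of_injective _ fun a b h => (Prod.ext_iff.1 h).1]

theorem doubled_rowLen_of_le (lam : StrictPartition) {i j : ℕ} (hj : j < lam.length)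
    (hi : lam.length ≤ i) (h : i < j + lam.part j) :
    lam.doubled.rowLen i = j + 1 + lam.legCount j (i + 1) := by
  have hrow : lam.doubled.row i
      = ((Finset.range lam.length).filter fun k => i + 1 ≤ k + lam.part k).image
        fun k => (i, k) := by
    ext ⟨a, b⟩
    have := lam.part_pos_iff b
    have := lam.part_pos_iff i
    simp only [YoungDiagram.mem_row_iff, mem_doubled, Finset.mem_image, Finset.mem_filter,
      Finset.mem_range, Prod.mk.injEq]
    constructor
    · rintro ⟨h1, rfl⟩
      exact ⟨b, by omega, rfl, rfl⟩
    · rintro ⟨k, h1, rfl, rfl⟩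
      omega
  rw [← lam.card_filter_range_eq hj h, YoungDiagram.rowLen_eq_card, hrow,
    Finset.card_image_of_injective _ fun a b h => (Prod.ext_iff.1 h).2]

/-- The hook lengths of the doubled distinct partition, in the three blocks `i, j < length`,
`i < length ≤ j` and `j < length ≤ i`. The last block repeats the second one without the column
`j = length`, in which the hook lengths are the parts. -/
@[to_additive]
theorem prod_boxHookLength_doubled {M : Type*} [CommMonoid M] (lam : StrictPartition)
    (g : ℕ → M) :
    (∏ c ∈ lam.doubled.cells, g (lam.doubled.boxHookLength c)) *
        ∏ i ∈ Finset.range lam.length, g (lam.part i)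
      = (∏ i ∈ Finset.range lam.length, ∏ j ∈ Finset.range lam.length,
          g (lam.part i + lam.part j)) *
        ((∏ i ∈ Finset.range lam.length, ∏ j ∈ Finset.Icc lam.length (i + lam.part i),
          g (lam.tailHook i j)) *
        ∏ i ∈ Finset.range lam.length, ∏ j ∈ Finset.Icc lam.length (i + lam.part i),
          g (lam.tailHook i j)) := by
  have hrow : ∏ c ∈ lam.doubled.cells.filter (fun c => c.1 < lam.length),
      g (lam.doubled.boxHookLength c)
        = (∏ i ∈ Finset.range lam.length, ∏ j ∈ Finset.range lam.length,
            g (lam.part i + lam.part j)) *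
          ∏ i ∈ Finset.range lam.length, ∏ j ∈ Finset.Icc lam.length (i + lam.part i),
            g (lam.tailHook i j) := by
    rw [Finset.prod_finset_product _ (Finset.range lam.length)
      (fun i => Finset.range (lam.doubled.rowLen i)), ← Finset.prod_mul_distrib]
    · refine Finset.prod_congr rfl fun i hi => ?_
      rw [Finset.mem_range] at hi
      have hlen := lam.length_le_add_part hi
      have hU : Finset.range (lam.doubled.rowLen i)
          = Finset.range lam.length ∪ Finset.Icc lam.length (i + lam.part i) := by
        rw [doubled_rowLen_of_lt _ hi]
        ext j
        simp only [Finset.mem_union, Finset.mem_range, Finset.mem_Icc]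
        omega
      rw [hU, Finset.prod_union]
      · congr 1
        · refine Finset.prod_congr rfl fun j hj => ?_
          rw [Finset.mem_range] at hj
          have := lam.length_le_add_part hj
          rw [YoungDiagram.boxHookLength, doubled_rowLen_of_lt _ hi, doubled_colLen_of_lt _ hj]
          congr 1
          omega
        · refine Finset.prod_congr rfl fun j hj => ?_
          rw [Finset.mem_Icc] at hj
          rw [YoungDiagram.boxHookLength, doubled_rowLen_of_lt _ hi,
            doubled_colLen_of_le _ hi hj.1 hj.2, tailHook]
          congr 1
          omega
      · rw [Finset.disjoint_left]
        intro j h1 h2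
        rw [Finset.mem_range] at h1
        rw [Finset.mem_Icc] at h2
        omega
    · rintro ⟨i, j⟩
      rw [Finset.mem_filter, YoungDiagram.mem_cells, YoungDiagram.mem_iff_lt_rowLen,
        Finset.mem_range, Finset.mem_range, and_comm]
  have hcol : (∏ c ∈ lam.doubled.cells.filter (fun c => ¬ c.1 < lam.length),
      g (lam.doubled.boxHookLength c)) * ∏ i ∈ Finset.range lam.length, g (lam.part i)
        = ∏ i ∈ Finset.range lam.length, ∏ j ∈ Finset.Icc lam.length (i + lam.part i),
            g (lam.tailHook i j) := by
    rw [Finset.prod_finset_product_right _ (Finset.range lam.length)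
      (fun j => Finset.Ico lam.length (j + lam.part j)), ← Finset.prod_mul_distrib]
    · refine Finset.prod_congr rfl fun j hj => ?_
      rw [Finset.mem_range] at hj
      have hlen := lam.length_le_add_part hj
      have htail : lam.tailHook j lam.length = lam.part j := by
        have h1 := lam.legCount_le j lam.length
        have h2 := lam.le_legCount (i := j) (j := lam.length) (k := lam.length - 1) (by omega)
          (lam.length_le_add_part (by omega))
        simp only [tailHook]
        omega
      rw [← Finset.mul_prod_Ioc_eq_prod_Icc hlen, htail, mul_comm]
      congr 1
      refine Finset.prod_bij' (fun i _ => i + 1) (fun i _ => i - 1) ?_ ?_ ?_ ?_ ?_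
      · intro i hi
        rw [Finset.mem_Ico] at hi
        rw [Finset.mem_Ioc]
        omega
      · intro i hi
        rw [Finset.mem_Ioc] at hi
        rw [Finset.mem_Ico]
        omega
      · intro i _
        exact Nat.add_sub_cancel i 1
      · intro i hi
        rw [Finset.mem_Ioc] at hi
        omega
      · intro i hi
        rw [Finset.mem_Ico] at hi
        rw [YoungDiagram.boxHookLength, doubled_rowLen_of_le _ hj hi.1 hi.2,
          doubled_colLen_of_lt _ hj, tailHook]
        congr 1
        omega
    · rintro ⟨i, j⟩
      have := lam.part_pos_iff i
      have := lam.part_pos_iff j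
      rw [Finset.mem_filter, YoungDiagram.mem_cells, mem_doubled, Finset.mem_range,
        Finset.mem_Ico]
      simp only
      omega
  rw [← Finset.prod_filter_mul_prod_filter_not lam.doubled.cells (fun c => c.1 < lam.length),
    mul_assoc, hcol, hrow, mul_assoc]

/-- The multiset of hook lengths of the doubled distinct partition consists of two copies of that
of the shifted diagram, with each part `x` traded for `2 * x` once. -/
@[to_additive]
theorem prod_boxHookLength_doubled_mul_prod_part {M : Type*} [CommMonoid M]
    (lam : StrictPartition) (g : ℕ → M) :
    (∏ c ∈ lam.doubled.cells, g (lam.doubled.boxHookLength c)) *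
        ∏ i ∈ Finset.range lam.length, g (lam.part i)
      = (∏ i ∈ Finset.range lam.length, g (2 * lam.part i)) *
        ((∏ c ∈ lam.cells, g (lam.hookLength c)) * ∏ c ∈ lam.cells, g (lam.hookLength c)) := by
  rw [prod_boxHookLength_doubled, prod_hookLength,
    prod_range_prod_range_symm lam.length (fun i j => g (lam.part i + lam.part j))
      (fun i j => by rw [add_comm])]
  simp only [← two_mul]
  rw [mul_assoc]
  congr 1
  exact mul_mul_mul_comm _ _ _ _

/-- The shifted hook lengths together with the differences of the parts are the numbers up to each
part together with the sums of two parts, as multisets. -/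
@[to_additive]
theorem prod_hookLength_mul_prod_sub {M : Type*} [CommMonoid M] (lam : StrictPartition)
    (g : ℕ → M) :
    (∏ c ∈ lam.cells, g (lam.hookLength c)) *
        ∏ i ∈ Finset.range lam.length, ∏ j ∈ Finset.Ioo i lam.length,
          g (lam.part i - lam.part j)
      = (∏ i ∈ Finset.range lam.length, ∏ t ∈ Finset.Icc 1 (lam.part i), g t) *
        ∏ i ∈ Finset.range lam.length, ∏ j ∈ Finset.Ioo i lam.length,
          g (lam.part i + lam.part j) := by
  rw [prod_hookLength, mul_assoc, mul_comm]
  congr 1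
  rw [← Finset.prod_mul_distrib]
  exact Finset.prod_congr rfl fun i hi =>
    lam.prod_tailHook_mul_prod_sub g (Finset.mem_range.1 hi)

end StrictPartition

/-! ### Product formula for the hook lengths and its variation in a cover -/

namespace StrictPartition

theorem hookProd_ne_zero (lam : StrictPartition) : (lam.hookProd : ℚ) ≠ 0 := by
  rw [Nat.cast_ne_zero, hookProd]
  refine Finset.prod_ne_zero_iff.2 fun c _ => ?_
  simp only [hookLength]
  omega

theorem part_lt_of_lt (lam : StrictPartition) {i j : ℕ} (hij : i < j) (hj : j ≤ lam.length) :
    lam.part j < lam.part i := by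
  rcases hj.lt_or_eq with h | rfl
  · exact lam.part_lt hij ((lam.part_pos_iff j).2 h)
  · rw [lam.part_eq_zero le_rfl]
    exact (lam.part_pos_iff i).2 hij

/-- `∏ part i ! * ∏_{i < j} (part i + part j) / (part i - part j)`. The zero part after the last
one may be included, since it contributes only factors `1`. -/
theorem hookProd_eq (lam : StrictPartition) {N : ℕ} (h1 : lam.length ≤ N)
    (h2 : N ≤ lam.length + 1) :
    (lam.hookProd : ℚ) = (∏ i ∈ Finset.range N, ((lam.part i).factorial : ℚ)) *
      ∏ i ∈ Finset.range N, ∏ j ∈ Finset.Ioo i N,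
        ((lam.part i : ℚ) + lam.part j) / (lam.part i - lam.part j) := by
  have hbase : (lam.hookProd : ℚ)
      = (∏ i ∈ Finset.range lam.length, ((lam.part i).factorial : ℚ)) *
        ∏ i ∈ Finset.range lam.length, ∏ j ∈ Finset.Ioo i lam.length,
          ((lam.part i : ℚ) + lam.part j) / (lam.part i - lam.part j) := by
    have h := lam.prod_hookLength_mul_prod_sub (fun t => (t : ℚ))
    have hsub : ∏ i ∈ Finset.range lam.length, ∏ j ∈ Finset.Ioo i lam.length,
          ((lam.part i - lam.part j : ℕ) : ℚ)
        = ∏ i ∈ Finset.range lam.length, ∏ j ∈ Finset.Ioo i lam.length,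
          ((lam.part i : ℚ) - lam.part j) := by
      refine Finset.prod_congr rfl fun i _ => Finset.prod_congr rfl fun j hj => ?_
      rw [Finset.mem_Ioo] at hj
      exact Nat.cast_sub (lam.part_lt_of_lt hj.1 hj.2.le).le
    have hne : ∏ i ∈ Finset.range lam.length, ∏ j ∈ Finset.Ioo i lam.length,
          ((lam.part i : ℚ) - lam.part j) ≠ 0 := by
      refine Finset.prod_ne_zero_iff.2 fun i _ => Finset.prod_ne_zero_iff.2 fun j hj => ?_
      rw [Finset.mem_Ioo] at hj
      exact sub_ne_zero.2 (Nat.cast_injective.ne (lam.part_lt_of_lt hj.1 hj.2.le).ne')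
    rw [hsub] at h
    simp only [Finset.prod_div_distrib]
    rw [← mul_div_assoc, eq_div_iff hne, hookProd, Nat.cast_prod, h]
    congr 1
    · refine Finset.prod_congr rfl fun i _ => ?_
      rw [← Finset.prod_Ico_id_eq_factorial, Nat.cast_prod, Finset.Ico_add_one_right_eq_Icc]
    · push_cast
      rfl
  rcases (by omega : N = lam.length ∨ N = lam.length + 1) with rfl | rfl
  · exact hbase
  · rw [hbase, Finset.prod_range_succ, Finset.prod_range_succ _ lam.length,
      lam.part_eq_zero le_rfl]
    congr 1
    · simp
    · rw [show Finset.Ioo lam.length (lam.length + 1) = ∅ by ext; simp,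
        Finset.prod_empty, mul_one]
      refine Finset.prod_congr rfl fun i hi => ?_
      have hi := (lam.part_pos_iff i).2 (Finset.mem_range.1 hi)
      refine Finset.prod_subset (Finset.Ioo_subset_Ioo_right (Nat.le_succ _)) fun j hj hj' => ?_
      rw [Finset.mem_Ioo] at hj hj'
      rw [lam.part_eq_zero (i := j) (by omega), Nat.cast_zero, add_zero, sub_zero, div_self]
      exact Nat.cast_ne_zero.2 hi.ne'

/-- `x * (x + 1)` for the part `x` in row `i`: twice the sum of the contents of the boxes in that
row, and the value that governs adding a box to it. -/
def outerContent (lam : StrictPartition) (i : ℕ) : ℚ := lam.part i * (lam.part i + 1)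

/-- `x * (x - 1)` for the part `x` in row `i`: the value that governs removing a box from it. -/
def innerContent (lam : StrictPartition) (i : ℕ) : ℚ := lam.part i * (lam.part i - 1)

/-- The change of the hook product when row `r` gains a box: only the pairs containing `r`
matter. -/
theorem hookProd_div_hookProd {nu lam : StrictPartition} {r N : ℕ}
    (h : lam.part = Function.update nu.part r (nu.part r + 1))
    (h1 : lam.length ≤ N) (h2 : N ≤ nu.length + 1) :
    (lam.hookProd : ℚ) / nu.hookProd = (nu.part r + 1) *
      ∏ j ∈ (Finset.range N).erase r, (nu.outerContent r - nu.outerContent j) /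
        (nu.outerContent r - nu.innerContent j) := by
  have hr := lt_length_of_part_eq_update h
  have hlen := length_of_part_eq_update h
  have h3 : nu.length ≤ N := by split_ifs at hlen <;> omega
  have h4 : N ≤ lam.length + 1 := by split_ifs at hlen <;> omega
  have hfac : (∏ i ∈ Finset.range N, ((lam.part i).factorial : ℚ)) /
      ∏ i ∈ Finset.range N, ((nu.part i).factorial : ℚ) = nu.part r + 1 := by
    rw [← Finset.prod_div_distrib, Finset.prod_eq_single r]
    · rw [h, Function.update_self, Nat.factorial_succ, Nat.cast_mul, mul_div_cancel_right₀]
      · push_cast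
        rfl
      · exact Nat.cast_ne_zero.2 (Nat.factorial_ne_zero _)
    · intro i _ hi
      rw [h, Function.update_of_ne hi, div_self]
      exact Nat.cast_ne_zero.2 (Nat.factorial_ne_zero _)
    · intro hn
      exact absurd (Finset.mem_range.2 (hr.trans_le h1)) hn
  rw [lam.hookProd_eq h1 h4, nu.hookProd_eq h3 h2, mul_div_mul_comm, hfac,
    ← Finset.prod_div_distrib]
  simp only [← Finset.prod_div_distrib]
  rw [prod_range_prod_Ioo_eq_prod_erase (hr.trans_le h1)]
  · congr 1
    refine Finset.prod_congr rfl fun j hj => ?_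
    rw [h, Function.update_self, Function.update_of_ne (Finset.mem_erase.1 hj).1,
      div_div_div_eq, outerContent, outerContent, innerContent]
    congr 1
    · push_cast
      ring
    · push_cast
      ring
  · intro i j
    rw [← neg_sub (lam.part i : ℚ), ← neg_sub (nu.part i : ℚ), div_neg, div_neg, neg_div_neg_eq,
      add_comm, add_comm (nu.part i : ℚ)]
  · intro i j hij hj hir hjr
    have hlt := nu.part_lt_of_lt hij (by omega)
    rw [h, Function.update_of_ne hir, Function.update_of_ne hjr]
    refine div_self (div_ne_zero ?_ ?_)
    · exact_mod_cast (by omega : nu.part i + nu.part j ≠ 0)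
    · exact sub_ne_zero.2 (Nat.cast_injective.ne hlt.ne')

theorem sum_outerContent_sub_innerContent (lam : StrictPartition) {N : ℕ} (hN : lam.length ≤ N) :
    ∑ i ∈ Finset.range N, lam.outerContent i - ∑ i ∈ Finset.range N, lam.innerContent i
      = 2 * lam.size := by
  rw [lam.size_eq_sum hN, ← Finset.sum_sub_distrib, Nat.cast_sum, Finset.mul_sum]
  refine Finset.sum_congr rfl fun i _ => ?_
  rw [outerContent, innerContent]
  ring

theorem part_injOn (lam : StrictPartition) :
    Set.InjOn lam.part (Finset.range (lam.length + 1) : Finset ℕ) := by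
  intro i hi j hj h
  rw [Finset.coe_range, Set.mem_Iio] at hi hj
  rcases lt_trichotomy i j with hlt | heq | hlt
  · have := lam.part_lt_of_lt hlt (by omega)
    omega
  · exact heq
  · have := lam.part_lt_of_lt hlt (by omega)
    omega

theorem outerContent_injOn (lam : StrictPartition) :
    Set.InjOn lam.outerContent (Finset.range (lam.length + 1) : Finset ℕ) := by
  intro i hi j hj h
  refine lam.part_injOn hi hj ?_
  have h1 : ((lam.part i : ℚ) - lam.part j) * (lam.part i + lam.part j + 1) = 0 := by
    rw [outerContent, outerContent] at h
    linear_combination h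
  rcases mul_eq_zero.1 h1 with h2 | h2
  · exact_mod_cast sub_eq_zero.1 h2
  · exact absurd h2 (by positivity)

theorem innerContent_injOn (lam : StrictPartition) :
    Set.InjOn lam.innerContent (Finset.range lam.length : Finset ℕ) := by
  intro i hi j hj h
  rw [Finset.coe_range, Set.mem_Iio] at hi hj
  refine lam.part_injOn (by simpa using hi.le) (by simpa using hj.le) ?_
  have h1 : ((lam.part i : ℚ) - lam.part j) * (lam.part i + lam.part j - 1) = 0 := by
    rw [innerContent, innerContent] at h
    linear_combination h
  rcases mul_eq_zero.1 h1 with h2 | h2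
  · exact_mod_cast sub_eq_zero.1 h2
  · have hi := (lam.part_pos_iff i).2 hi
    have hj := (lam.part_pos_iff j).2 hj
    have h3 : lam.part i + lam.part j = 1 := by exact_mod_cast sub_eq_zero.1 h2
    omega

/-! ### The transition probabilities -/

/-- The weight `2 ^ (|lam| - ℓ(lam)) / H(lam)`. -/
noncomputable def weight (lam : StrictPartition) : ℚ :=
  2 ^ ((lam.size : ℤ) - lam.length) / lam.hookProd

theorem weight_ne_zero (lam : StrictPartition) : lam.weight ≠ 0 :=
  div_ne_zero (zpow_ne_zero _ two_ne_zero) lam.hookProd_ne_zero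

/-- The factor by which the weight changes when row `r ≤ length` gains a box. It is zero when
that row cannot gain one. -/
noncomputable def transition (nu : StrictPartition) (r : ℕ) : ℚ :=
  (∏ j ∈ Finset.range nu.length, (nu.outerContent r - nu.innerContent j)) /
    ∏ j ∈ (Finset.range (nu.length + 1)).erase r, (nu.outerContent r - nu.outerContent j)

theorem weight_eq_weight_mul_transition {nu lam : StrictPartition} {r : ℕ}
    (h : lam.part = Function.update nu.part r (nu.part r + 1)) :
    lam.weight = nu.weight * nu.transition r := by
  have hr := le_length_of_part_eq_update h
  have hlen := length_of_part_eq_update h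
  have hsize := (mem_above.1 (mem_above_one.2 ⟨r, h⟩)).2
  have hH := hookProd_div_hookProd (N := nu.length + 1) h
    (by split_ifs at hlen <;> omega) le_rfl
  have hz : nu.innerContent nu.length = 0 := by
    rw [innerContent, nu.part_eq_zero le_rfl, Nat.cast_zero, zero_mul]
  have hne : ∏ j ∈ (Finset.range (nu.length + 1)).erase r,
      (nu.outerContent r - nu.innerContent j) ≠ 0 := by
    refine Finset.prod_ne_zero_iff.2 fun j hj => ?_
    rw [Finset.mem_erase, Finset.mem_range] at hj
    have hlr : lam.part r = nu.part r + 1 := by rw [h, Function.update_self]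
    have hlj : lam.part j = nu.part j := by rw [h, Function.update_of_ne hj.1]
    have hne1 : nu.part r + 1 ≠ nu.part j := by
      intro heq
      rw [← hlr, ← hlj] at heq
      rcases lt_or_gt_of_ne hj.1 with hlt | hlt
      · have := lam.part_lt hlt (by omega)
        omega
      · have := lam.part_lt hlt (by omega)
        omega
    have hne2 : nu.part r + nu.part j ≠ 0 := by
      have h1 := nu.part_pos_iff r
      have h2 := nu.part_pos_iff j
      omega
    have hfac : nu.outerContent r - nu.innerContent j
        = (((nu.part r + 1 : ℕ) : ℚ) - (nu.part j : ℕ)) * ((nu.part r + nu.part j : ℕ) : ℚ) := by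
      rw [outerContent, innerContent]
      push_cast
      ring
    rw [hfac]
    exact mul_ne_zero (sub_ne_zero.2 (Nat.cast_injective.ne hne1)) (Nat.cast_ne_zero.2 hne2)
  have hy : ∏ j ∈ (Finset.range (nu.length + 1)).erase r,
      (nu.outerContent r - nu.outerContent j) ≠ 0 := by
    refine Finset.prod_ne_zero_iff.2 fun j hj => ?_
    rw [Finset.mem_erase] at hj
    exact sub_ne_zero.2 fun heq => hj.1 (nu.outerContent_injOn hj.2
      (Finset.mem_coe.2 (Finset.mem_range.2 (by omega))) heq.symm)
  -- The numerator of `transition` lacks the factor of the row `length` instead of that of row `r`.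
  have hnum : (∏ j ∈ Finset.range nu.length, (nu.outerContent r - nu.innerContent j)) *
      nu.outerContent r = (∏ j ∈ (Finset.range (nu.length + 1)).erase r,
        (nu.outerContent r - nu.innerContent j)) * (2 * nu.part r) := by
    have h1 := Finset.prod_range_succ
      (fun j => nu.outerContent r - nu.innerContent j) nu.length
    rw [hz, sub_zero] at h1
    rw [← h1, ← Finset.prod_erase_mul _ _ (Finset.mem_range.2 (Nat.lt_succ_of_le hr))]
    congr 1
    rw [outerContent, innerContent]
    ring
  have hH0 := nu.hookProd_ne_zero
  have hH1 : (lam.hookProd : ℚ) = nu.hookProd * ((nu.part r + 1) *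
      ∏ j ∈ (Finset.range (nu.length + 1)).erase r, (nu.outerContent r - nu.outerContent j) /
        (nu.outerContent r - nu.innerContent j)) := by
    rw [← hH, mul_div_cancel₀ _ hH0]
  rw [Finset.prod_div_distrib] at hH1
  have hx : (nu.part r : ℚ) + 1 ≠ 0 := by positivity
  rw [weight, weight, transition, hH1]
  rcases hr.lt_or_eq with hlt | heq
  · rw [if_pos hlt] at hlen
    have hpos : (nu.part r : ℚ) ≠ 0 := Nat.cast_ne_zero.2 ((nu.part_pos_iff r).2 hlt).ne'
    have hnum' : (∏ j ∈ Finset.range nu.length, (nu.outerContent r - nu.innerContent j)) *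
        (nu.part r + 1) = (∏ j ∈ (Finset.range (nu.length + 1)).erase r,
          (nu.outerContent r - nu.innerContent j)) * 2 := by
      refine mul_right_cancel₀ hpos ?_
      rw [outerContent] at hnum ⊢
      linear_combination hnum
    rw [hlen, hsize, show ((nu.size + 1 : ℕ) : ℤ) - nu.length = nu.size - nu.length + 1 by
      push_cast; ring, zpow_add_one₀ two_ne_zero]
    field_simp
    linear_combination -hnum'
  · rw [if_neg (by omega)] at hlen
    have herase : (Finset.range (nu.length + 1)).erase r = Finset.range nu.length := by
      rw [heq]
      ext j
      simp only [Finset.mem_erase, Finset.mem_range]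
      omega
    rw [herase] at hne hy ⊢
    have hpart : nu.part r = 0 := nu.part_eq_zero heq.ge
    rw [hlen, hsize, hpart, show ((nu.size + 1 : ℕ) : ℤ) - (nu.length + 1 : ℕ)
      = nu.size - nu.length by push_cast; ring]
    field_simp
    simp

/-- Sums over the covers of `nu`, weighted by the ratio of weights, are sums over all rows up to
the first empty one: rows that cannot gain a box have transition probability zero. -/
theorem sum_above_one_weight_mul (nu : StrictPartition) (G : StrictPartition → ℚ) (g : ℕ → ℚ)
    (hG : ∀ lam r, lam.part = Function.update nu.part r (nu.part r + 1) → G lam = g r) :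
    ∑ lam ∈ above nu 1, lam.weight * G lam
      = nu.weight * ∑ r ∈ Finset.range (nu.length + 1), nu.transition r * g r := by
  have hex : ∀ lam ∈ above nu 1,
      ∃ r, lam.part = Function.update nu.part r (nu.part r + 1) := fun lam h =>
    mem_above_one.1 h
  choose! e he using hex
  rw [Finset.mul_sum]
  refine Finset.sum_of_injOn e ?_ ?_ ?_ ?_
  · intro a ha b hb hab
    refine part_injective ?_
    rw [he a ha, he b hb, hab]
  · intro a ha
    have := le_length_of_part_eq_update (he a ha)
    exact Finset.mem_coe.2 (Finset.mem_range.2 (by omega))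
  · intro r hr hn
    rw [Finset.mem_range] at hr
    obtain ⟨i, hi, hi'⟩ : ∃ i < nu.length, nu.part i = nu.part r + 1 := by
      by_contra! hcon
      obtain ⟨lam, hlam⟩ := nu.exists_part_eq_update (by omega) hcon
      have hmem : lam ∈ above nu 1 := mem_above_one.2 ⟨r, hlam⟩
      exact hn ⟨lam, hmem, row_unique_of_part_eq_update (he lam hmem) hlam⟩
    rw [transition, Finset.prod_eq_zero (Finset.mem_range.2 hi), zero_div, zero_mul, mul_zero]
    rw [outerContent, innerContent, hi']
    push_cast
    ring
  · intro lam h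
    rw [weight_eq_weight_mul_transition (he lam h), hG lam _ (he lam h), mul_assoc]

theorem sum_transition (nu : StrictPartition) :
    ∑ r ∈ Finset.range (nu.length + 1), nu.transition r = 1 :=
  sum_prod_sub_div_prod_sub_eq_one nu.outerContent_injOn (by simp)

theorem sum_transition_mul_outerContent (nu : StrictPartition) :
    ∑ r ∈ Finset.range (nu.length + 1), nu.transition r * nu.outerContent r = 2 * nu.size := by
  rw [← nu.sum_outerContent_sub_innerContent (Nat.le_succ _),
    ← sum_prod_sub_div_prod_sub_eq_sub nu.outerContent_injOn (w := nu.innerContent) rfl]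
  refine Finset.sum_congr rfl fun r _ => ?_
  rw [transition, Finset.prod_range_succ, innerContent, nu.part_eq_zero le_rfl, Nat.cast_zero,
    zero_mul, sub_zero, div_mul_eq_mul_div]

/-- Removing a box in all possible ways, the ratios of hook products add up to the size. -/
theorem sum_hookProd_div_hookProd (lam : StrictPartition) (D : Finset StrictPartition)
    (hD : ∀ nu, nu ∈ D ↔ lam ∈ above nu 1) :
    ∑ nu ∈ D, (lam.hookProd : ℚ) / nu.hookProd = lam.size := by
  have hex : ∀ nu ∈ D,
      ∃ r, lam.part = Function.update nu.part r (nu.part r + 1) := fun nu h =>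
    mem_above_one.1 ((hD nu).1 h)
  choose! e he using hex
  have hrow : ∑ nu ∈ D, (lam.hookProd : ℚ) / nu.hookProd
      = ∑ r ∈ Finset.range lam.length, -(1 / 2) *
        ((∏ j ∈ Finset.range lam.length, (lam.innerContent r - lam.outerContent j)) /
          ∏ j ∈ (Finset.range lam.length).erase r,
            (lam.innerContent r - lam.innerContent j)) := by
    refine Finset.sum_of_injOn e ?_ ?_ ?_ ?_
    · intro a ha b hb hab
      exact eq_of_part_eq_update (he a ha) (hab ▸ he b hb)
    · intro a ha
      exact Finset.mem_coe.2 (Finset.mem_range.2 (lt_length_of_part_eq_update (he a ha)))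
    · intro r hr hn
      rw [Finset.mem_range] at hr
      obtain ⟨i, hi, hi'⟩ : ∃ i < lam.length, lam.part i + 1 = lam.part r := by
        by_contra! hcon
        obtain ⟨nu, hnu⟩ := lam.exists_update_eq_part hr hcon
        have hmem : nu ∈ D := (hD nu).2 (mem_above_one.2 ⟨r, hnu⟩)
        exact hn ⟨nu, hmem, row_unique_of_part_eq_update (he nu hmem) hnu⟩
      rw [Finset.prod_eq_zero (Finset.mem_range.2 hi), zero_div, mul_zero]
      rw [outerContent, innerContent, ← hi']
      push_cast
      ring
    · intro nu hnu
      have h := he nu hnu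
      have hr := lt_length_of_part_eq_update h
      have hlen := length_of_part_eq_update h
      have hx : (lam.part (e nu) : ℚ) = nu.part (e nu) + 1 := by
        rw [h, Function.update_self]
        push_cast
        rfl
      have hy : nu.outerContent (e nu) = lam.innerContent (e nu) := by
        rw [outerContent, innerContent, hx]
        ring
      rw [hookProd_div_hookProd h le_rfl (by split_ifs at hlen <;> omega),
        ← Finset.mul_prod_erase (Finset.range lam.length) _ (Finset.mem_range.2 hr), hy, ← hx,
        Finset.prod_div_distrib]
      have h1 : ∀ j ∈ (Finset.range lam.length).erase (e nu), nu.part j = lam.part j := by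
        intro j hj
        rw [h, Function.update_of_ne (Finset.mem_erase.1 hj).1]
      have h2 : ∏ j ∈ (Finset.range lam.length).erase (e nu),
            (lam.innerContent (e nu) - nu.outerContent j)
          = ∏ j ∈ (Finset.range lam.length).erase (e nu),
            (lam.innerContent (e nu) - lam.outerContent j) :=
        Finset.prod_congr rfl fun j hj => by rw [outerContent, outerContent, h1 j hj]
      have h3 : ∏ j ∈ (Finset.range lam.length).erase (e nu),
            (lam.innerContent (e nu) - nu.innerContent j)
          = ∏ j ∈ (Finset.range lam.length).erase (e nu),
            (lam.innerContent (e nu) - lam.innerContent j) :=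
        Finset.prod_congr rfl fun j hj => by rw [innerContent, innerContent, innerContent, h1 j hj]
      rw [h2, h3]
      rw [show lam.innerContent (e nu) - lam.outerContent (e nu) = -2 * lam.part (e nu) by
        rw [innerContent, outerContent]; ring]
      ring
  rw [hrow, ← Finset.mul_sum, sum_prod_sub_div_prod_sub_eq_sub lam.innerContent_injOn rfl]
  linear_combination (1 / 2) * lam.sum_outerContent_sub_innerContent le_rfl

/-! ### The sum of the squared hook lengths of the doubled distinct partition -/

theorem sum_Icc_sq (n : ℕ) :
    ∑ t ∈ Finset.Icc 1 n, (t : ℚ) ^ 2 = n * (n + 1) * (2 * n + 1) / 6 := by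
  induction n with
  | zero => simp
  | succ n ih =>
    rw [Finset.sum_Icc_succ_top (by omega), ih]
    push_cast
    ring

theorem p1_eq (lam : StrictPartition) {N : ℕ} (hN : lam.length ≤ N) :
    (lam.p1 : ℚ) = 4 * (lam.size : ℚ) ^ 2
      + ∑ i ∈ Finset.range N, (2 * (lam.part i : ℚ) ^ 3 + lam.part i) / 3 := by
  have h0 : ∑ i ∈ Finset.range N, (2 * (lam.part i : ℚ) ^ 3 + lam.part i) / 3
      = ∑ i ∈ Finset.range lam.length, (2 * (lam.part i : ℚ) ^ 3 + lam.part i) / 3 := by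
    refine (Finset.sum_subset (by simpa using hN) fun i _ hi => ?_).symm
    rw [lam.part_eq_zero (by simpa using hi)]
    simp
  have h1 := lam.sum_boxHookLength_doubled_add_sum_part (fun t => (t : ℚ) ^ 2)
  have h2 := lam.sum_hookLength_add_sum_sub (fun t => (t : ℚ) ^ 2)
  have h3 := sum_range_sum_range_symm lam.length
    (fun i j => (lam.part i : ℚ) * lam.part j) (fun i j => mul_comm _ _)
  have h4 : (lam.size : ℚ) ^ 2 = ∑ i ∈ Finset.range lam.length, ∑ j ∈ Finset.range lam.length,
      (lam.part i : ℚ) * lam.part j := by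
    rw [← Finset.sum_mul_sum, lam.size_eq_sum le_rfl, Nat.cast_sum, sq]
  have h5 : ∑ i ∈ Finset.range lam.length, ∑ j ∈ Finset.Ioo i lam.length,
        ((lam.part i + lam.part j : ℕ) : ℚ) ^ 2
      = ∑ i ∈ Finset.range lam.length, ∑ j ∈ Finset.Ioo i lam.length,
        ((lam.part i - lam.part j : ℕ) : ℚ) ^ 2
      + 4 * ∑ i ∈ Finset.range lam.length, ∑ j ∈ Finset.Ioo i lam.length,
        (lam.part i : ℚ) * lam.part j := by
    rw [Finset.mul_sum, ← Finset.sum_add_distrib]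
    refine Finset.sum_congr rfl fun i _ => ?_
    rw [Finset.mul_sum, ← Finset.sum_add_distrib]
    refine Finset.sum_congr rfl fun j hj => ?_
    rw [Finset.mem_Ioo] at hj
    rw [Nat.cast_sub (lam.part_lt_of_lt hj.1 hj.2.le).le]
    push_cast
    ring
  have h6 : ∑ i ∈ Finset.range lam.length, (2 * (lam.part i : ℚ) ^ 3 + lam.part i) / 3
      = 2 * ∑ i ∈ Finset.range lam.length, ∑ t ∈ Finset.Icc 1 (lam.part i), (t : ℚ) ^ 2
        - ∑ i ∈ Finset.range lam.length, (lam.part i : ℚ) * lam.part i := by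
    rw [Finset.mul_sum, ← Finset.sum_sub_distrib]
    refine Finset.sum_congr rfl fun i _ => ?_
    rw [sum_Icc_sq]
    ring
  have h7 : ∑ i ∈ Finset.range lam.length, ((2 * lam.part i : ℕ) : ℚ) ^ 2
      = 4 * ∑ i ∈ Finset.range lam.length, (lam.part i : ℚ) * lam.part i := by
    rw [Finset.mul_sum]
    refine Finset.sum_congr rfl fun i _ => ?_
    push_cast
    ring
  have h8 : ∑ i ∈ Finset.range lam.length, (lam.part i : ℚ) ^ 2
      = ∑ i ∈ Finset.range lam.length, (lam.part i : ℚ) * lam.part i := by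
    simp only [sq]
  rw [h0, h6, p1]
  push_cast
  linear_combination h1 + 2 * h2 + 2 * h5 - 4 * h3 - 4 * h4 + h7 - h8

theorem p1_eq_add_of_part_eq_update {nu lam : StrictPartition} {r : ℕ}
    (h : lam.part = Function.update nu.part r (nu.part r + 1)) :
    (lam.p1 : ℚ) = nu.p1 + (8 * nu.size + 2 * nu.outerContent r + 5) := by
  have hr := le_length_of_part_eq_update h
  have hlen := length_of_part_eq_update h
  have hsize := (mem_above.1 (mem_above_one.2 ⟨r, h⟩)).2
  have hmem : r ∈ Finset.range (nu.length + 1) := Finset.mem_range.2 (by omega)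
  rw [lam.p1_eq (N := nu.length + 1) (by split_ifs at hlen <;> omega),
    nu.p1_eq (N := nu.length + 1) (by omega), hsize, ← Finset.add_sum_erase _ _ hmem,
    ← Finset.add_sum_erase _ _ hmem]
  have hrest : ∑ i ∈ (Finset.range (nu.length + 1)).erase r,
      (2 * (lam.part i : ℚ) ^ 3 + lam.part i) / 3
        = ∑ i ∈ (Finset.range (nu.length + 1)).erase r,
          (2 * (nu.part i : ℚ) ^ 3 + nu.part i) / 3 := by
    refine Finset.sum_congr rfl fun i hi => ?_
    rw [h, Function.update_of_ne (Finset.mem_erase.1 hi).1]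
  rw [hrest, h, Function.update_self, outerContent]
  push_cast
  ring

theorem sum_above_one_weight (nu : StrictPartition) :
    ∑ lam ∈ above nu 1, lam.weight = nu.weight := by
  have h := nu.sum_above_one_weight_mul (fun _ => 1) (fun _ => 1) fun _ _ _ => rfl
  simpa [sum_transition] using h

theorem sum_above_one_weight_mul_p1 (nu : StrictPartition) :
    ∑ lam ∈ above nu 1, lam.weight * lam.p1 = nu.weight * (nu.p1 + (12 * nu.size + 5)) := by
  rw [nu.sum_above_one_weight_mul _ _ fun lam r h => p1_eq_add_of_part_eq_update h]
  congr 1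
  have h1 : ∀ r, nu.transition r * (nu.p1 + (8 * nu.size + 2 * nu.outerContent r + 5))
      = (nu.p1 + 8 * nu.size + 5) * nu.transition r
        + 2 * (nu.transition r * nu.outerContent r) := fun r => by ring
  simp only [h1]
  rw [Finset.sum_add_distrib, ← Finset.mul_sum, ← Finset.mul_sum, sum_transition,
    sum_transition_mul_outerContent]
  ring

/-- `H(doubled lam) = 2 ^ ℓ(lam) * H(lam) ^ 2`. -/
theorem boxHookProd_doubled (lam : StrictPartition) :
    lam.doubled.boxHookProd = 2 ^ lam.length * lam.hookProd ^ 2 := by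
  have h := lam.prod_boxHookLength_doubled_mul_prod_part id
  have hpos : 0 < ∏ i ∈ Finset.range lam.length, lam.part i :=
    Finset.prod_pos fun i hi => (lam.part_pos_iff i).2 (Finset.mem_range.1 hi)
  refine Nat.eq_of_mul_eq_mul_right hpos ?_
  simp only [id, Finset.prod_mul_distrib, Finset.prod_const, Finset.card_range] at h
  rw [YoungDiagram.boxHookProd, h, hookProd]
  ring

end StrictPartition

/-! ### Counting standard tableaux by removing the largest entry -/

/-- The bijective labellings of `D` by `0, …, #D - 1` that increase along the relation `r`,
extended by zero outside `D`. -/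
def linearLabellings {α : Type*} (r : α → α → Prop) (D : Finset α) : Set (α → ℕ) :=
  {T | (∀ c ∈ D, T c < D.card) ∧ Set.InjOn T D ∧ (∀ c ∉ D, T c = 0) ∧
    ∀ c ∈ D, ∀ d ∈ D, r c d → T c < T d}

theorem finite_linearLabellings {α : Type*} (r : α → α → Prop) (D : Finset α) :
    (linearLabellings r D).Finite := by
  refine Set.Finite.of_injOn (f := fun (T : α → ℕ) (c : D) => T c)
    (t := Set.pi Set.univ fun _ => Set.Iio D.card) ?_ ?_
    (Set.Finite.pi fun _ => Set.finite_Iio _)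
  · exact fun T hT c _ => hT.1 c c.2
  · intro T hT T' hT' h
    funext c
    by_cases hc : c ∈ D
    · exact congrFun h ⟨c, hc⟩
    · rw [hT.2.2.1 c hc, hT'.2.2.1 c hc]

/-- The largest label sits at an element of `D` that is maximal for `r`, and deleting it leaves a
labelling of the rest. -/
theorem ncard_linearLabellings {α : Type*} [DecidableEq α] (r : α → α → Prop) (D : Finset α)
    (hD : D.Nonempty) (M : Finset α) (hM : ∀ c, c ∈ M ↔ c ∈ D ∧ ∀ d ∈ D, ¬ r c d) :
    (linearLabellings r D).ncard = ∑ c ∈ M, (linearLabellings r (D.erase c)).ncard := by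
  have hpos := hD.card_pos
  have hcard : ∀ c ∈ D, (D.erase c).card = D.card - 1 := fun c hc => Finset.card_erase_of_mem hc
  simp only [Set.ncard_eq_toFinset_card _ (finite_linearLabellings _ _)]
  rw [← Finset.card_sigma]
  symm
  refine Finset.card_bij (fun p _ => Function.update p.2 p.1 (D.card - 1)) ?_ ?_ ?_
  · rintro ⟨c, T⟩ h
    rw [Finset.mem_sigma, Set.Finite.mem_toFinset] at h
    obtain ⟨hc, hlt, hinj, hzero, hmono⟩ := h
    rw [hM] at hc
    simp only [hcard c hc.1] at hlt hinj hzero hmono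
    have hlt' : ∀ d ∈ D, d ≠ c → T d < D.card - 1 := fun d hd hdc =>
      hlt d (Finset.mem_erase.2 ⟨hdc, hd⟩)
    rw [Set.Finite.mem_toFinset]
    refine ⟨fun d hd => ?_, fun d hd d' hd' heq => ?_, fun d hd => ?_, fun d hd d' hd' hr => ?_⟩
    · rcases eq_or_ne d c with rfl | hdc
      · simp only [Function.update_self]
        omega
      · have := hlt' d hd hdc
        simp only [Function.update_of_ne hdc]
        omega
    · rcases eq_or_ne d c with h | hdc <;> rcases eq_or_ne d' c with h' | hdc'
      · rw [h, h']
      · have := hlt' d' hd' hdc'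
        subst h
        simp only [Function.update_self, Function.update_of_ne hdc'] at heq
        omega
      · have := hlt' d hd hdc
        subst h'
        simp only [Function.update_self, Function.update_of_ne hdc] at heq
        omega
      · simp only [Function.update_of_ne hdc, Function.update_of_ne hdc'] at heq
        exact hinj (Finset.mem_coe.2 (Finset.mem_erase.2 ⟨hdc, hd⟩))
          (Finset.mem_coe.2 (Finset.mem_erase.2 ⟨hdc', hd'⟩)) heq
    · have hdc : d ≠ c := fun h => hd (h ▸ hc.1)
      simp only [Function.update_of_ne hdc]
      exact hzero d fun h => hd (Finset.mem_of_mem_erase h)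
    · have hdc : d ≠ c := by
        rintro rfl
        exact hc.2 d' hd' hr
      rcases eq_or_ne d' c with rfl | hdc'
      · have := hlt' d hd hdc
        simpa only [Function.update_self, Function.update_of_ne hdc] using this
      · simp only [Function.update_of_ne hdc, Function.update_of_ne hdc']
        exact hmono d (Finset.mem_erase.2 ⟨hdc, hd⟩) d' (Finset.mem_erase.2 ⟨hdc', hd'⟩) hr
  · rintro ⟨c, T⟩ h ⟨c', T'⟩ h' heq
    rw [Finset.mem_sigma, Set.Finite.mem_toFinset] at h h'
    obtain ⟨hc, hlt, -, hzero, -⟩ := h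
    obtain ⟨hc', hlt', -, hzero', -⟩ := h'
    rw [hM] at hc hc'
    simp only [hcard c hc.1, hcard c' hc'.1] at hlt hlt' hzero hzero' heq hc hc'
    have hcc : c = c' := by
      by_contra hne
      have h1 := congrFun heq c
      rw [Function.update_self, Function.update_of_ne hne] at h1
      have := hlt' c (Finset.mem_erase.2 ⟨hne, hc.1⟩)
      omega
    subst hcc
    congr 1
    funext d
    rcases eq_or_ne d c with rfl | hdc
    · rw [hzero d (Finset.notMem_erase d D), hzero' d (Finset.notMem_erase d D)]
    · have h1 := congrFun heq d
      rwa [Function.update_of_ne hdc, Function.update_of_ne hdc] at h1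
  · intro T hT
    rw [Set.Finite.mem_toFinset] at hT
    obtain ⟨hlt, hinj, hzero, hmono⟩ := hT
    have himage : D.image T = Finset.range D.card := by
      refine Finset.eq_of_subset_of_card_le (fun a ha => ?_) ?_
      · obtain ⟨c, hc, rfl⟩ := Finset.mem_image.1 ha
        exact Finset.mem_range.2 (hlt c hc)
      · rw [Finset.card_range, Finset.card_image_of_injOn hinj]
    obtain ⟨c, hc, hTc⟩ : ∃ c ∈ D, T c = D.card - 1 := by
      have : D.card - 1 ∈ D.image T := by
        rw [himage, Finset.mem_range]
        omega
      simpa using this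
    have hmax : c ∈ M := by
      refine (hM c).2 ⟨hc, fun d hd hr => ?_⟩
      have h1 := hmono c hc d hd hr
      have h2 := hlt d hd
      omega
    refine ⟨⟨c, Function.update T c 0⟩, ?_, ?_⟩
    · rw [Finset.mem_sigma, Set.Finite.mem_toFinset]
      refine ⟨hmax, fun d hd => ?_, fun d hd d' hd' heq => ?_, fun d hd => ?_,
        fun d hd d' hd' hr => ?_⟩
      · rw [Finset.mem_erase] at hd
        simp only [hcard c hc, Function.update_of_ne hd.1]
        have h1 := hlt d hd.2
        have h2 : T d ≠ T c := fun h => hd.1 (hinj hd.2 hc h)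
        omega
      · rw [Finset.mem_coe, Finset.mem_erase] at hd hd'
        simp only [Function.update_of_ne hd.1, Function.update_of_ne hd'.1] at heq
        exact hinj hd.2 hd'.2 heq
      · rcases eq_or_ne d c with rfl | hdc
        · simp
        · simp only [Function.update_of_ne hdc]
          exact hzero d fun h => hd (Finset.mem_erase.2 ⟨hdc, h⟩)
      · rw [Finset.mem_erase] at hd hd'
        simp only [Function.update_of_ne hd.1, Function.update_of_ne hd'.1]
        exact hmono d hd.2 d' hd'.2 hr
    · simp only
      rw [Function.update_idem, ← hTc, Function.update_eq_self]

namespace StrictPartition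

/-- One box lies to the left of the other in the same row, or above it in the same column. -/
def Precedes (c d : ℕ × ℕ) : Prop := (c.1 = d.1 ∧ c.2 < d.2) ∨ (c.2 = d.2 ∧ c.1 < d.1)

theorem numTableaux_eq_ncard (lam mu : StrictPartition) :
    lam.numTableaux mu = (linearLabellings Precedes (lam.skewCells mu)).ncard := by
  rw [numTableaux, ← Nat.card_coe_set_eq]
  set D := lam.skewCells mu with hD
  have hval : ∀ (T : D ≃ Fin D.card) (c : ℕ × ℕ) (h : c ∈ D),
      (fun c => if h : c ∈ D then (T ⟨c, h⟩ : ℕ) else 0) c = T ⟨c, h⟩ := fun T c h => dif_pos h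
  refine Nat.card_congr (Equiv.ofBijective (fun T : StandardTableau lam mu =>
    ⟨fun c => if h : c ∈ D then (T.1 ⟨c, h⟩ : ℕ) else 0, ?_, ?_, ?_, ?_⟩) ⟨?_, ?_⟩)
  · intro c hc
    rw [hval _ c hc]
    exact (T.1 ⟨c, hc⟩).2
  · intro c hc d hd h
    rw [hval _ c hc, hval _ d hd] at h
    exact congrArg Subtype.val (T.1.injective (Fin.ext h))
  · intro c hc
    exact dif_neg hc
  · intro c hc d hd h
    rw [hval _ c hc, hval _ d hd]
    rcases h with h | h
    · exact T.2.1 ⟨c, hc⟩ ⟨d, hd⟩ h.1 h.2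
    · exact T.2.2 ⟨c, hc⟩ ⟨d, hd⟩ h.1 h.2
  · intro T T' h
    refine Subtype.ext (Equiv.ext fun c => Fin.ext ?_)
    have h1 := congrFun (congrArg Subtype.val h) c.1
    simp only at h1
    rwa [dif_pos c.2, dif_pos c.2] at h1
  · rintro ⟨T, hlt, hinj, hzero, hmono⟩
    have hbij : Function.Bijective fun c : D => (⟨T c, hlt c c.2⟩ : Fin D.card) := by
      rw [Fintype.bijective_iff_injective_and_card]
      refine ⟨fun c d h => ?_, by simp⟩
      exact Subtype.ext (hinj c.2 d.2 (congrArg Fin.val h))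
    refine ⟨⟨Equiv.ofBijective _ hbij, ?_, ?_⟩, ?_⟩
    · exact fun c d h1 h2 => hmono c c.2 d d.2 (Or.inl ⟨h1, h2⟩)
    · exact fun c d h1 h2 => hmono c c.2 d d.2 (Or.inr ⟨h1, h2⟩)
    · refine Subtype.ext (funext fun c => ?_)
      by_cases hc : c ∈ D
      · simp only
        rw [dif_pos hc]
        rfl
      · simp only
        rw [dif_neg hc, hzero c hc]

theorem cells_of_part_eq_update {nu lam : StrictPartition} {r : ℕ}
    (h : lam.part = Function.update nu.part r (nu.part r + 1)) :
    nu.cells = lam.cells.erase (r, r + lam.part r) := by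
  ext ⟨i, j⟩
  rw [Finset.mem_erase, mem_cells, mem_cells, Ne, Prod.mk.injEq, h]
  rcases eq_or_ne i r with rfl | hi
  · rw [Function.update_self]
    omega
  · rw [Function.update_of_ne hi]
    omega

/-- The boxes that can hold the largest entry of a standard tableau of shape `lam / mu` are those
whose removal leaves a strict partition containing `mu`. -/
theorem numTableaux_eq_sum {mu lam : StrictPartition} {n : ℕ} (hlam : lam ∈ above mu (n + 1))
    (D : Finset StrictPartition) (hD : ∀ nu, nu ∈ D ↔ nu ∈ above mu n ∧ lam ∈ above nu 1) :
    lam.numTableaux mu = ∑ nu ∈ D, nu.numTableaux mu := by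
  classical
  rw [mem_above] at hlam
  have hne : (lam.skewCells mu).Nonempty := by
    have := card_skewCells hlam.1
    rw [← Finset.card_pos]
    omega
  have hmem : ∀ i j, (i, j) ∈ lam.skewCells mu ↔
      (i < j ∧ j ≤ i + lam.part i) ∧ i + mu.part i < j := by
    intro i j
    rw [skewCells, Finset.mem_sdiff, mem_cells, mem_cells]
    omega
  rw [numTableaux_eq_ncard, ncard_linearLabellings Precedes _ hne
    ((lam.skewCells mu).filter fun c => ∀ d ∈ lam.skewCells mu, ¬ Precedes c d)
    fun c => Finset.mem_filter]
  have hex : ∀ nu ∈ D,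
      ∃ r, lam.part = Function.update nu.part r (nu.part r + 1) := fun nu h =>
    mem_above_one.1 ((hD nu).1 h).2
  choose! e he using hex
  symm
  refine Finset.sum_bij (fun nu _ => (e nu, e nu + lam.part (e nu))) ?_ ?_ ?_ ?_
  · intro nu hnu
    have h := he nu hnu
    have hle := (mem_above.1 ((hD nu).1 hnu).1).1
    have hle' := hle (e nu)
    have hr : lam.part (e nu) = nu.part (e nu) + 1 := by rw [h, Function.update_self]
    rw [Finset.mem_filter, hmem]
    refine ⟨by omega, ?_⟩
    rintro ⟨i, j⟩ hd hprec
    rw [hmem] at hd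
    rcases hprec with ⟨h1, h2⟩ | ⟨h1, h2⟩
    · simp only at h1 h2
      rw [← h1] at hd
      omega
    · simp only at h1 h2
      have hi : lam.part i = nu.part i := by rw [h, Function.update_of_ne h2.ne']
      have := nu.add_part_le h2.le (by omega)
      omega
  · intro a ha b hb hab
    have hrow : e a = e b := (Prod.ext_iff.1 hab).1
    exact eq_of_part_eq_update (he a ha) (hrow ▸ he b hb)
  · rintro ⟨i, j⟩ hc
    rw [Finset.mem_filter, hmem] at hc
    obtain ⟨hc, hmax⟩ := hc
    have hj : j = i + lam.part i := by
      by_contra hj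
      exact hmax (i, j + 1) ((hmem _ _).2 (by omega)) (Or.inl ⟨rfl, Nat.lt_succ_self j⟩)
    have hpos : 0 < lam.part i := by omega
    obtain ⟨nu, hnu⟩ : ∃ nu : StrictPartition,
        lam.part = Function.update nu.part i (nu.part i + 1) := by
      refine lam.exists_update_eq_part ((lam.part_pos_iff i).1 hpos) fun k hk hki => ?_
      have hkpos := (lam.part_pos_iff k).2 hk
      have hik : i < k := by
        by_contra! hle
        rcases hle.lt_or_eq with hlt | rfl
        · have := lam.part_lt hlt hpos
          omega
        · omega
      have h1 := lam.add_part_le hik.le hkpos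
      refine hmax (k, j) ((hmem _ _).2 ⟨by omega, ?_⟩) (Or.inr ⟨rfl, hik⟩)
      by_contra! hle
      have := mu.add_part_le hik.le (by omega)
      omega
    have hnui : lam.part i = nu.part i + 1 := by rw [hnu, Function.update_self]
    have hcov : lam ∈ above nu 1 := mem_above_one.2 ⟨i, hnu⟩
    have hle : mu ≤ nu := by
      intro k
      rcases eq_or_ne k i with rfl | hk
      · omega
      · have := hlam.1 k
        rwa [hnu, Function.update_of_ne hk] at this
    have hnuD : nu ∈ D := by
      refine (hD nu).2 ⟨mem_above.2 ⟨hle, ?_⟩, hcov⟩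
      have := (mem_above.1 hcov).2
      omega
    refine ⟨nu, hnuD, ?_⟩
    rw [row_unique_of_part_eq_update (he nu hnuD) hnu, hj]
  · intro nu hnu
    rw [numTableaux_eq_ncard, skewCells, skewCells, cells_of_part_eq_update (he nu hnu),
      Finset.erase_sdiff_comm]

theorem above_zero (mu : StrictPartition) : above mu 0 = {mu} := by
  ext lam
  rw [mem_above, Finset.mem_singleton]
  constructor
  · rintro ⟨hle, hs⟩
    have hsub := cells_subset_iff.2 hle
    have hcells := Finset.eq_of_subset_of_card_le hsub (by rw [card_cells, card_cells]; omega)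
    have hge := cells_subset_iff.1 hcells.symm.subset
    exact part_injective (funext fun i => le_antisymm (hge i) (hle i))
  · rintro rfl
    exact ⟨lam.le_refl, rfl⟩

theorem numTableaux_self (mu : StrictPartition) : mu.numTableaux mu = 1 := by
  rw [numTableaux_eq_ncard, Set.ncard_eq_one]
  refine ⟨0, Set.eq_singleton_iff_unique_mem.2 ⟨?_, fun T hT => funext fun c => ?_⟩⟩
  · simp [linearLabellings, skewCells]
  · exact hT.2.2.1 c (by simp [skewCells])

/-! ### Averages along growing chains of strict partitions -/

/-- A sum over `lam ⊇ mu` weighted by numbers of tableaux is evaluated one box at a time. -/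
theorem sum_above_succ_numTableaux_mul (mu : StrictPartition) (n : ℕ)
    (G : StrictPartition → ℚ) :
    ∑ lam ∈ above mu (n + 1), (lam.numTableaux mu : ℚ) * G lam
      = ∑ nu ∈ above mu n, (nu.numTableaux mu : ℚ) * ∑ lam ∈ above nu 1, G lam := by
  classical
  have h1 : ∀ lam ∈ above mu (n + 1), (lam.numTableaux mu : ℚ) * G lam
      = ∑ nu ∈ (above mu n).filter fun nu => lam ∈ above nu 1,
        (nu.numTableaux mu : ℚ) * G lam := by
    intro lam hlam
    rw [numTableaux_eq_sum hlam _ fun nu => Finset.mem_filter, Nat.cast_sum, Finset.sum_mul]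
  rw [Finset.sum_congr rfl h1]
  simp only [Finset.mul_sum]
  refine Finset.sum_comm' fun lam nu => ?_
  rw [Finset.mem_filter]
  refine ⟨fun h => ⟨h.2.2, h.2.1⟩, fun h => ⟨?_, h.2, h.1⟩⟩
  rw [mem_above] at h ⊢
  rw [mem_above] at h
  exact ⟨le_trans h.2.1 h.1.1, by omega⟩

theorem sum_above_numTableaux_mul_weight (mu : StrictPartition) (n : ℕ) :
    ∑ lam ∈ above mu n, (lam.numTableaux mu : ℚ) * lam.weight = mu.weight := by
  induction n with
  | zero => simp [above_zero, numTableaux_self]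
  | succ n ih =>
    rw [sum_above_succ_numTableaux_mul, ← ih]
    simp only [sum_above_one_weight]

theorem sum_above_numTableaux_mul_weight_mul_p1 (mu : StrictPartition) (n : ℕ) :
    ∑ lam ∈ above mu n, (lam.numTableaux mu : ℚ) * (lam.weight * lam.p1)
      = mu.weight * (mu.p1 + (12 * (n.choose 2 : ℚ) + (12 * (mu.size : ℚ) + 5) * n)) := by
  induction n with
  | zero => simp [above_zero, numTableaux_self]
  | succ n ih =>
    rw [sum_above_succ_numTableaux_mul]
    have h1 : ∀ nu ∈ above mu n,
        (nu.numTableaux mu : ℚ) * ∑ lam ∈ above nu 1, lam.weight * lam.p1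
          = (nu.numTableaux mu : ℚ) * (nu.weight * nu.p1)
            + (nu.numTableaux mu : ℚ) * nu.weight * (12 * (mu.size + n) + 5) := by
      intro nu hnu
      rw [sum_above_one_weight_mul_p1, (mem_above.1 hnu).2]
      push_cast
      ring
    rw [Finset.sum_congr rfl h1, Finset.sum_add_distrib, ih, ← Finset.sum_mul,
      sum_above_numTableaux_mul_weight, Nat.choose_succ_succ, Nat.choose_one_right]
    push_cast
    ring

/-- The empty strict partition. -/
def empty : StrictPartition := ⟨[], List.Pairwise.nil, by simp⟩

theorem empty_le (lam : StrictPartition) : empty ≤ lam := fun i => by simp [empty, part]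

theorem mem_above_empty {lam : StrictPartition} {n : ℕ} :
    lam ∈ above empty n ↔ lam.size = n := by
  rw [mem_above]
  simp [empty_le, show empty.size = 0 from rfl]

/-- The hook length formula for strict partitions. -/
theorem numTableaux_empty_mul_hookProd (lam : StrictPartition) :
    (lam.numTableaux empty : ℚ) * lam.hookProd = lam.size.factorial := by
  classical
  obtain ⟨n, hn⟩ : ∃ n, lam.size = n := ⟨_, rfl⟩
  induction n generalizing lam with
  | zero =>
    have h : lam ∈ above empty 0 := mem_above_empty.2 hn
    rw [above_zero, Finset.mem_singleton] at h
    rw [h, numTableaux_self]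
    simp [hookProd, cells, empty, length, size]
  | succ n ih =>
    have hD : ∀ nu, nu ∈ (above empty n).filter (fun nu => lam ∈ above nu 1)
        ↔ nu ∈ above empty n ∧ lam ∈ above nu 1 := fun nu => Finset.mem_filter
    have hD' : ∀ nu, nu ∈ (above empty n).filter (fun nu => lam ∈ above nu 1)
        ↔ lam ∈ above nu 1 := by
      intro nu
      rw [hD, mem_above_empty]
      refine ⟨fun h => h.2, fun h => ⟨?_, h⟩⟩
      have := (mem_above.1 h).2
      omega
    rw [numTableaux_eq_sum (mem_above_empty.2 hn) _ hD, Nat.cast_sum, Finset.sum_mul]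
    have hterm : ∀ nu ∈ (above empty n).filter (fun nu => lam ∈ above nu 1),
        (nu.numTableaux empty : ℚ) * lam.hookProd
          = n.factorial * ((lam.hookProd : ℚ) / nu.hookProd) := by
      intro nu hnu
      have hs := mem_above_empty.1 ((hD nu).1 hnu).1
      have h1 := ih nu hs
      rw [hs] at h1
      rw [← h1]
      have := nu.hookProd_ne_zero
      field_simp
    rw [Finset.sum_congr rfl hterm, ← Finset.mul_sum, sum_hookProd_div_hookProd _ _ hD', hn,
      Nat.factorial_succ]
    push_cast
    ring

theorem card_doubled (lam : StrictPartition) : lam.doubled.card = 2 * lam.size := by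
  have h := lam.sum_boxHookLength_doubled_add_sum_part (fun _ => 1)
  simp only [Finset.sum_const, smul_eq_mul, mul_one, Finset.card_range, card_cells] at h
  change lam.doubled.cells.card = _
  omega

theorem withDoubledSize_two_mul (n : ℕ) : withDoubledSize (2 * n) = above empty n := by
  ext lam
  rw [mem_above_empty, withDoubledSize, Set.Finite.mem_toFinset, Set.mem_ofPred_eq, card_doubled]
  omega

end StrictPartition

/-! ### Both identities -/

theorem mainTheorem7 :
    (∀ (mu : StrictPartition) (n : ℕ),
      ∑ lam ∈ StrictPartition.above mu n,
          (2 : ℚ) ^ ((lam.size : ℤ) - lam.length - mu.size + mu.length)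
            * (lam.numTableaux mu : ℚ) * (mu.hookProd : ℚ) / (lam.hookProd : ℚ)
            * ((lam.p1 : ℚ) - (mu.p1 : ℚ))
        = 12 * (n.choose 2 : ℚ) + (12 * (mu.size : ℚ) + 5) * n) ∧
    (∀ n : ℕ,
      (2 : ℚ) ^ n * (n.factorial : ℚ) *
          ∑ lam ∈ StrictPartition.withDoubledSize (2 * n),
            1 / (lam.doubled.boxHookProd : ℚ)
              * ∑ c ∈ lam.doubled.cells, (lam.doubled.boxHookLength c : ℚ) ^ 2
        = 12 * (n.choose 2 : ℚ) + 5 * n) := by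
  refine ⟨fun mu n => ?_, fun n => ?_⟩
  · have hterm : ∀ lam : StrictPartition,
        (2 : ℚ) ^ ((lam.size : ℤ) - lam.length - mu.size + mu.length)
            * (lam.numTableaux mu : ℚ) * (mu.hookProd : ℚ) / (lam.hookProd : ℚ)
            * ((lam.p1 : ℚ) - (mu.p1 : ℚ))
          = ((lam.numTableaux mu : ℚ) * (lam.weight * lam.p1)
              - (lam.numTableaux mu : ℚ) * lam.weight * mu.p1) / mu.weight := by
      intro lam
      have h1 := lam.hookProd_ne_zero
      have h2 := mu.hookProd_ne_zero
      have h3 : (2 : ℚ) ^ ((mu.size : ℤ) - mu.length) ≠ 0 := zpow_ne_zero _ two_ne_zero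
      rw [StrictPartition.weight, StrictPartition.weight,
        show (lam.size : ℤ) - lam.length - mu.size + mu.length
          = (lam.size - lam.length) - (mu.size - mu.length) by ring, zpow_sub₀ two_ne_zero]
      field_simp
    rw [Finset.sum_congr rfl fun lam _ => hterm lam, ← Finset.sum_div, Finset.sum_sub_distrib,
      ← Finset.sum_mul, StrictPartition.sum_above_numTableaux_mul_weight,
      StrictPartition.sum_above_numTableaux_mul_weight_mul_p1, div_eq_iff mu.weight_ne_zero]
    ring
  · have h := StrictPartition.sum_above_numTableaux_mul_weight_mul_p1 StrictPartition.empty n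
    have hw : StrictPartition.empty.weight = 1 := by
      simp [StrictPartition.weight, StrictPartition.empty, StrictPartition.size,
        StrictPartition.length, StrictPartition.hookProd, StrictPartition.cells]
    have hs : (StrictPartition.empty.size : ℚ) = 0 := by
      simp [StrictPartition.empty, StrictPartition.size]
    have hp : (StrictPartition.empty.p1 : ℚ) = 0 := by
      rw [StrictPartition.p1_eq (N := 0) _ (by simp [StrictPartition.empty,
        StrictPartition.length]), hs]
      simp
    rw [hw, hs, hp] at h
    have hrhs : 12 * (n.choose 2 : ℚ) + 5 * n
        = 1 * (0 + (12 * (n.choose 2 : ℚ) + (12 * 0 + 5) * n)) := by ring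
    rw [hrhs, ← h, StrictPartition.withDoubledSize_two_mul, Finset.mul_sum]
    refine Finset.sum_congr rfl fun lam hlam => ?_
    have hsize := StrictPartition.mem_above_empty.1 hlam
    have hf := lam.numTableaux_empty_mul_hookProd
    have h1 := lam.hookProd_ne_zero
    rw [lam.boxHookProd_doubled, ← hsize, ← hf, StrictPartition.weight,
      zpow_sub₀ two_ne_zero, zpow_natCast, zpow_natCast, StrictPartition.p1]
    push_cast
    field_simp
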